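/- **Conventions.** All sets and functions live on $\mathbb R^2$; $\mathcal L^2$ is Lebesgue measure, $\mathcal H^1$ is one-dimensional Hausdorff measure, $B_r(x)$ is the open ball, $a^\perp=(-a_2,a_1)$. Every locally integrable scalar function $f$ (and each component of $\nabla f$) is taken to be its precise representative: $f(x)=\lim_{r\to0}\frac1{\mathcal L^2(B_r(x))}\int_{B_r(x)}f\,dy$ if this limit exists and is finite, and $f(x)=0$ otherwise. A point $x$ is a *Lebesgue point* of $f$ if $\lim_{r\to0}\frac1{\mathcal L^2(B_r(x))}\int_{B_r(x)}|f(y)-f(x)|\,dy=0$. For a measurable set $E$ of finite perimeter, let $D\mathbb 1_E$ be the distributional gradient of its indicator (a finite vector measure), $|D\mathbb 1_E|$ its total variation, and $\partial^M E$ the set of points at which $E$ has neither density $0$ nor density $1$. The generalized inner normal is $\nu_E(x)=\lim_{r\to0}D\mathbb 1_E(B_r(x))/|D\mathbb 1_E|(B_r(x))$, defined at those $x$ where this limit exists and has norm $1$. A *closed simple Lipschitz curve* is a Lipschitz map $\gamma:[0,1]\to\mathbb R^2$ with $\gamma(0)=\gamma(1)$ that is injective on $[0,1)$. If moreover $\gamma'\neq0$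 a.e., put $\mu_\gamma=\tau\,\mathcal H^1\llcorner\gamma([0,1])$, where $\tau(\gamma(s))=\gamma'(s)/|\gamma'(s)|$ for a.e. $s$. A *family of generalized connected components of* $\partial^M E$ is an at most countable family of closed simple Lipschitz curves $\gamma_i$ with $\gamma_i'\ne0$ a.e. such that $D\mathbb 1_E=\sum_i(\mu_{\gamma_i})^\perp$, $|D\mathbb 1_E|=\sum_i|\mu_{\gamma_i}|$, and the measures $|\mu_{\gamma_i}|$ are pairwise mutually singular. A number $t\in\mathbb R$ is a *regular value* of $f$ if $\{f>t\}$ has finite perimeter, $\partial^M\{f>t\}=\{f=t\}$ up to an $\mathcal H^1$-negligible set, and $\nabla f\neq0$ and $\nu_{\{f>t\}}=\nabla f/|\nabla f|$ hold $\mathcal H^1$-a.e. on $\{f=t\}$. For such $t$, an *essential level set* $\{f=t\}^*$ is the union $\bigcup_i\gamma_i([0,1])$ over a family $(\gamma_i)$ of generalized connected components of $\partial^M\{f>t\}$. **Proposition.** Let $f\in W^{1,2}(\mathbb R^2)$ (precisely represented). Then: 1. Let $h\in\mathbb R$ and let $C\subset\mathbb R^2$ be a connected set with $\operatorname{diam}C>0$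 (possibly infinite). If $f(x)=h$ for $\mathcal H^1$-a.e. $x\in C$, then every $x\in\overline C$ is a Lebesgue point of $f$ and $f(x)=h$. 2. Let $\gamma:[0,1]\to\mathbb R^2$ be a closed simple Lipschitz curve and $h\in\mathbb R$. If $f(x)=h$ for $\mathcal H^1$-a.e. $x\in\gamma([0,1])$, then for every $t\in[0,1]$ the point $\gamma(t)$ is a Lebesgue point of $f$ and $f(\gamma(t))=h$. 3. For every regular value $h$ of $f$ and every essential level set $\{f=h\}^*$ (that is, for every choice of the family of curves), all points of $\{f=h\}^*$ are Lebesgue points of $f$, and $\{f=h\}^*\subset\{f=h\}$. -/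

import Mathlib

open MeasureTheory Set Filter Topology
open scoped ENNReal NNReal ContDiff

noncomputable section

/-- The Euclidean plane `ℝ²`. -/
abbrev Plane : Type := EuclideanSpace ℝ (Fin 2)

/-! ### Test fields, Sobolev functions, precise representatives -/

/-- Smooth compactly supported vector fields on the plane. -/
structure IsTestField (φ : Plane → Plane) : Prop where
  smooth : ContDiff ℝ ∞ φ
  compactSupport : HasCompactSupport φ

/-- The divergence of a vector field. -/
def divergence (φ : Plane → Plane) (x : Plane) : ℝ :=
  ∑ i : Fin 2, fderiv ℝ φ x (EuclideanSpace.single i 1) i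

/-- `G` is a weak (distributional) gradient of `f`. -/
structure IsWeakGradient (f : Plane → ℝ) (G : Plane → Plane) : Prop where
  locInt : LocallyIntegrable f
  locInt_grad : LocallyIntegrable G
  integral_eq : ∀ φ : Plane → Plane, IsTestField φ →
    ∫ x, f x * divergence φ x = - ∫ x, inner ℝ (φ x) (G x)

/-- Membership in the Sobolev space `W^{1,2}(ℝ²)`. -/
def MemW12 (f : Plane → ℝ) : Prop :=
  MemLp f 2 ∧ ∃ G : Plane → Plane, MemLp G 2 ∧ IsWeakGradient f G

open scoped Classical in
/-- The precise representative: the limit of the means over shrinking balls where this limit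
exists and is finite, and `0` elsewhere. -/
def preciseRep (f : Plane → ℝ) (x : Plane) : ℝ :=
  if hx : ∃ c : ℝ, Tendsto (fun r : ℝ => ⨍ y in Metric.ball x r, f y) (𝓝[>] 0) (𝓝 c)
  then Classical.choose hx else 0

/-- `x` is a Lebesgue point of `f`, with value `f x`. -/
def IsLebesguePoint (f : Plane → ℝ) (x : Plane) : Prop :=
  Tendsto (fun r : ℝ => ⨍ y in Metric.ball x r, |f y - f x|) (𝓝[>] 0) (𝓝 0)

/-- The precise representative of a vector field, component by component. -/
def preciseRepField (G : Plane → Plane) (x : Plane) : Plane :=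
  WithLp.toLp 2 (fun i => preciseRep (fun y => G y i) x)

/-! ### Sets of finite perimeter -/

/-- The perimeter of a set in the plane. -/
def perimeter (E : Set Plane) : ℝ≥0∞ :=
  ⨆ (φ : Plane → Plane) (_ : IsTestField φ) (_ : ∀ x, ‖φ x‖ ≤ 1),
    ENNReal.ofReal (∫ x in E, divergence φ x)

/-- Sets of finite perimeter. -/
structure HasFinitePerimeter (E : Set Plane) : Prop where
  nullMeasurable : NullMeasurableSet E
  perimeter_lt_top : perimeter E < ⊤

/-- The set `E^α` of points at which `E` has density `α`. -/
def densityPoints (E : Set Plane) (α : ℝ≥0∞) : Set Plane :=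
  {x | Tendsto (fun r : ℝ => volume (Metric.ball x r ∩ E) / volume (Metric.ball x r))
    (𝓝[>] 0) (𝓝 α)}

/-- The essential boundary `∂^M E = ℝ² \ (E⁰ ∪ E¹)`. -/
def essentialBoundary (E : Set Plane) : Set Plane :=
  (densityPoints E 0 ∪ densityPoints E 1)ᶜ

/-- The (finite) vector measure `D` is the distributional gradient `D 𝟙_E` of the indicator
of `E`. -/
def IsIndicatorGradient (E : Set Plane) (D : VectorMeasure Plane Plane) : Prop :=
  ∀ φ : Plane → Plane, IsTestField φ →
    ∫ x in E, divergence φ x = - D.integral φ (innerSL ℝ)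

/-- `x` belongs to the reduced boundary of `E` and `ν` is the generalized inner normal to `E`
at `x`. -/
def IsInnerNormal (E : Set Plane) (x ν : Plane) : Prop :=
  ∃ D : VectorMeasure Plane Plane, IsIndicatorGradient E D ∧
    Tendsto (fun r : ℝ => (D.variation (Metric.ball x r)).toReal⁻¹ • D (Metric.ball x r))
      (𝓝[>] 0) (𝓝 ν) ∧ ‖ν‖ = 1

/-! ### Regular values -/

/-- `t` is a regular value of `f`: the superlevel set `{f > t}` has finite perimeter, its
essential boundary is `{f = t}` modulo `ℋ¹`, and its generalized inner normal is `∇f / |∇f|`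
at `ℋ¹`-a.e. point of `{f = t}`. Where `∇f = 0` the quotient is `0` in Lean, which is not a unit
vector, so the last condition also says that `∇f ≠ 0` at `ℋ¹`-a.e. point of `{f = t}`. -/
structure IsRegularValue (f : Plane → ℝ) (t : ℝ) : Prop where
  finitePerimeter : HasFinitePerimeter {x | t < f x}
  boundary_eq : essentialBoundary {x | t < f x} =ᵐ[μH[1]] {x | f x = t}
  normal_eq : ∃ G : Plane → Plane, IsWeakGradient f G ∧
    ∀ᵐ x ∂(μH[1] : Measure Plane), f x = t →
      IsInnerNormal {y | t < f y} x (‖preciseRepField G x‖⁻¹ • preciseRepField G x)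

/-! ### Curves and essential level sets -/

/-- Closed simple Lipschitz curves parametrized by `[0, 1]`; values outside `[0, 1]` are
irrelevant. -/
structure IsClosedSimpleLipschitz (γ : ℝ → Plane) : Prop where
  lipschitz : ∃ K : ℝ≥0, LipschitzOnWith K γ (Icc 0 1)
  closed : γ 0 = γ 1
  simple : InjOn γ (Ico 0 1)

/-- The trace `γ([0, 1])`. -/
def curveTrace (γ : ℝ → Plane) : Set Plane := γ '' Icc 0 1

/-- The unit tangent field `τ(γ(s)) = γ'(s) / |γ'(s)|` of a closed simple curve. -/
def tangentField (γ : ℝ → Plane) (x : Plane) : Plane :=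
  let s := Function.invFunOn γ (Ico 0 1) x
  ‖deriv γ s‖⁻¹ • deriv γ s

/-- The vector measure `μ_γ = τ ℋ¹⌞γ([0, 1])` induced by a closed simple curve. -/
def curveMeasure (γ : ℝ → Plane) : VectorMeasure Plane Plane :=
  (μH[1].restrict (curveTrace γ)).withDensityᵥ (tangentField γ)

/-- The rotation `a ↦ a^⊥ = (-a₂, a₁)`. -/
def perp : Plane →ₗ[ℝ] Plane where
  toFun a := !₂[-a 1, a 0]
  map_add' a b := by
    ext i; fin_cases i <;> simp [add_comm]
  map_smul' c a := by
    ext i; fin_cases i <;> simp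

/-- The rotated vector measure `μ^⊥`. -/
def perpMeasure (μ : VectorMeasure Plane Plane) : VectorMeasure Plane Plane :=
  μ.mapRange perp.toAddMonoidHom perp.continuous_of_finiteDimensional

/-- `(γ i)` is a family of generalized connected components of the essential boundary of `E`:
closed simple Lipschitz curves with `γ' ≠ 0` a.e. such that `D 𝟙_E = ∑ (μ_{γ i})^⊥`,
`|D 𝟙_E| = ∑ |μ_{γ i}|`, and the measures `|μ_{γ i}|` are pairwise mutually singular. -/
structure IsBoundaryCurveFamily {ι : Type} (E : Set Plane) (γ : ι → ℝ → Plane) : Prop where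
  countable : Countable ι
  curve : ∀ i, IsClosedSimpleLipschitz (γ i)
  deriv_ne_zero : ∀ i, ∀ᵐ s ∂(volume.restrict (Icc (0 : ℝ) 1)), deriv (γ i) s ≠ 0
  gradient_eq : ∃ D : VectorMeasure Plane Plane, IsIndicatorGradient E D ∧
    (∀ B : Set Plane, MeasurableSet B →
      HasSum (fun i => perpMeasure (curveMeasure (γ i)) B) (D B)) ∧
    D.variation = Measure.sum (fun i => (curveMeasure (γ i)).variation)
  singular : Pairwise fun i j =>
    (curveMeasure (γ i)).variation ⟂ₘ (curveMeasure (γ j)).variation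

/-- `S` is an essential level set `{f = t}^*`: the union of the traces of a family of generalized
connected components of the essential boundary of `{f > t}`. The family is not unique, and every
admissible choice is allowed. -/
def IsEssentialLevelSet (f : Plane → ℝ) (t : ℝ) (S : Set Plane) : Prop :=
  ∃ (ι : Type) (γ : ι → ℝ → Plane), IsBoundaryCurveFamily {x | t < f x} γ ∧
    S = ⋃ i, curveTrace (γ i)

end

open scoped Convolution

/-! In the plane the Poincaré inequality for `∫|∇f|²` is scale invariant: on `B_r(x)` the mean
distance of `f` from its mean over a comparable sub-ball is at most a constant times the square root
of the energy of `B_{4r}(x)`, which tends to `0` with `r`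
(`IsWeakGradient.setAverage_abs_sub_ballMean_le`). So `f` has vanishing mean oscillation at every
point, and only the value of the means has to be pinned down. For a connected set `C` and `x` in its
closure, the distances from points of `C` to `x` fill an interval, while a Vitali covering shows
that points around which the energy grows faster than linearly have distances of small measure.
Hence at each small scale `r` there is a point `y ∈ C` near `x` with `f y = h` and linear energy
growth (`exists_energyGrowth_of_isConnected`). At such a point the dyadic differences of means sum
geometrically, so the mean over `B_{r/2}(y)` is close to `f y = h`. This gives the first claim; the
second is the case of a trace, which is connected and has positive diameter. For the third claim it
suffices that `ℋ¹`-almost every point of each boundary curve lies in the essential boundary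
(`IsBoundaryCurveFamily.ae_mem_essentialBoundary`). Near almost every point of a curve its tangent
is nearly constant and the other curves are negligible, so `D 𝟙_E` tested on a cutoff at scale `r`
is at least of order `r` along a sequence of radii. Density `0` or `1` would make it `o(r)`. -/

/-! ### Translation estimates for functions with a weak gradient -/

theorem divergence_smul_const {g : Plane → ℝ} {y : Plane} (hg : DifferentiableAt ℝ g y)
    (v : Plane) : divergence (fun y => g y • v) y = fderiv ℝ g y v := by
  have hv : v = v 0 • EuclideanSpace.single 0 1 + v 1 • EuclideanSpace.single 1 1 := by
    ext i; fin_cases i <;> simp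
  have hF : HasFDerivAt (fun y => g y • v) ((fderiv ℝ g y).smulRight v) y :=
    hg.hasFDerivAt.smul_const v
  rw [divergence, hF.fderiv, Fin.sum_univ_two]
  simp only [ContinuousLinearMap.smulRight_apply, PiLp.smul_apply, smul_eq_mul]
  conv_rhs => rw [hv, map_add, map_smul, map_smul, smul_eq_mul, smul_eq_mul]
  ring

theorem fderiv_comp_sub_left {η : Plane → ℝ} (hη : ContDiff ℝ ∞ η) (x y v : Plane) :
    fderiv ℝ (fun y => η (x - y)) y v = - fderiv ℝ η (x - y) v := by
  have hηd : DifferentiableAt ℝ η (x - y) := hη.differentiable (by simp) _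
  have h : HasFDerivAt (fun y => η (x - y))
      ((fderiv ℝ η (x - y)).comp (-ContinuousLinearMap.id ℝ Plane)) y :=
    hηd.hasFDerivAt.comp y ((hasFDerivAt_id y).const_sub x)
  rw [h.fderiv]
  simp

/-- The weak gradient tested against a reflected translate of a scalar function. -/
theorem IsWeakGradient.integral_fderiv_comp_sub {f : Plane → ℝ} {G : Plane → Plane}
    (hG : IsWeakGradient f G) {η : Plane → ℝ} (hη : ContDiff ℝ ∞ η) (hηc : HasCompactSupport η)
    (x v : Plane) :
    ∫ y, fderiv ℝ η (x - y) v * f y = ∫ y, η (x - y) * inner ℝ v (G y) := by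
  have hηx : ContDiff ℝ ∞ fun y => η (x - y) := by fun_prop
  have hηs : HasCompactSupport fun y => η (x - y) :=
    hηc.comp_homeomorph (Homeomorph.subLeft x)
  have hφ : IsTestField (fun y => η (x - y) • v) :=
    ⟨hηx.smul contDiff_const, hηs.smul_right⟩
  have h2 := hG.integral_eq _ hφ
  have hd : ∀ y, divergence (fun y => η (x - y) • v) y = - fderiv ℝ η (x - y) v := fun y => by
    rw [divergence_smul_const (hηx.differentiable (by simp) y), fderiv_comp_sub_left hη]
  simp only [hd, inner_smul_left, RCLike.conj_to_real, mul_neg, integral_neg, neg_inj] at h2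
  rw [← h2]
  simp only [mul_comm]

/-- The line derivative of a mollification of `f` is the mollification of the weak derivative. -/
theorem IsWeakGradient.fderiv_convolution {f : Plane → ℝ} {G : Plane → Plane}
    (hG : IsWeakGradient f G) {η : Plane → ℝ} (hη : ContDiff ℝ ∞ η) (hηc : HasCompactSupport η)
    (x v : Plane) :
    fderiv ℝ (η ⋆[ContinuousLinearMap.lsmul ℝ ℝ, volume] f) x v
      = ∫ t, η t * inner ℝ v (G (x - t)) := by
  have h1 := hηc.hasFDerivAt_convolution_left (ContinuousLinearMap.lsmul ℝ ℝ)
    (hη.of_le (by simp)) hG.locInt (μ := volume) x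
  have hex : Integrable (fun t => ((ContinuousLinearMap.lsmul ℝ ℝ).precompL Plane
      (fderiv ℝ η t)) (f (x - t))) volume :=
    (hηc.fderiv ℝ).convolutionExists_left _ (hη.continuous_fderiv (by simp)) hG.locInt x
  rw [h1.fderiv, convolution_def, ContinuousLinearMap.integral_apply hex]
  have h2 := hG.integral_fderiv_comp_sub hη hηc x v
  rw [← integral_sub_left_eq_self (fun y => fderiv ℝ η (x - y) v * f y) volume x,
    ← integral_sub_left_eq_self (fun y => η (x - y) * inner ℝ v (G y)) volume x] at h2
  simp only [sub_sub_cancel] at h2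
  exact h2

theorem enorm_add_sub_le_lintegral {u : Plane → ℝ} (hu : ContDiff ℝ 1 u) (z v : Plane) :
    ‖u (z + v) - u z‖ₑ ≤ ∫⁻ θ in Icc (0 : ℝ) 1, ‖fderiv ℝ u (z + θ • v) v‖ₑ := by
  have hd : ∀ θ : ℝ, HasDerivAt (fun θ : ℝ => u (z + θ • v)) (fderiv ℝ u (z + θ • v) v) θ := by
    intro θ
    have h1 : HasDerivAt (fun θ : ℝ => z + θ • v) v θ := by
      simpa using ((hasDerivAt_id θ).smul_const v).const_add z
    exact ((hu.differentiable (by simp) _).hasFDerivAt).comp_hasDerivAt θ h1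
  have hc : Continuous fun θ : ℝ => fderiv ℝ u (z + θ • v) v := by
    have := hu.continuous_fderiv (by simp)
    fun_prop
  have h := intervalIntegral.integral_eq_sub_of_hasDerivAt (a := 0) (b := 1)
    (fun θ _ => hd θ) (hc.intervalIntegrable _ _)
  simp only [one_smul, zero_smul, add_zero] at h
  rw [← h, intervalIntegral.integral_of_le zero_le_one, Measure.restrict_congr_set Ioc_ae_eq_Icc]
  exact enorm_integral_le_lintegral_enorm _

theorem lintegral_ball_comp_add_le {g : Plane → ℝ≥0∞} {x w : Plane} {r R : ℝ}
    (h : r + ‖w‖ ≤ R) : ∫⁻ z in Metric.ball x r, g (z + w) ≤ ∫⁻ z in Metric.ball x R, g z := by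
  have hmp := measurePreserving_add_right (volume : Measure Plane) w
  have he : MeasurableEmbedding (fun z : Plane => z + w) := measurableEmbedding_addRight w
  calc ∫⁻ z in Metric.ball x r, g (z + w)
      ≤ ∫⁻ z in (fun z => z + w) ⁻¹' Metric.ball x R, g (z + w) := by
        refine lintegral_mono_set fun z hz => ?_
        simp only [mem_preimage, Metric.mem_ball] at hz ⊢
        calc dist (z + w) x ≤ dist z x + ‖w‖ := by
              rw [dist_eq_norm, dist_eq_norm, add_sub_right_comm]; exact norm_add_le _ _
          _ < R := by linarith
    _ = ∫⁻ z in Metric.ball x R, g z := hmp.setLIntegral_comp_preimage_emb he _ _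

/-- The smooth mollification obeys the fundamental theorem of calculus along the segment from `z` to
`z + v`, and its derivative is a mollification of `G`. After Tonelli, each shift `θ • v - t` has
length at most `‖v‖ + δ`, so the translated ball stays inside `B_R`. -/
theorem IsWeakGradient.lintegral_translate_convolution_le {f : Plane → ℝ} {G : Plane → Plane}
    (hG : IsWeakGradient f G) (hGm : Measurable G) {η : Plane → ℝ} (hη : ContDiff ℝ ∞ η)
    (hηc : HasCompactSupport η) {x v : Plane} {r R δ : ℝ}
    (hsupp : ∀ t, δ < ‖t‖ → η t = 0) (hR : r + ‖v‖ + δ ≤ R) :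
    ∫⁻ z in Metric.ball x r, ‖(η ⋆[ContinuousLinearMap.lsmul ℝ ℝ, volume] f) (z + v)
        - (η ⋆[ContinuousLinearMap.lsmul ℝ ℝ, volume] f) z‖ₑ
      ≤ ‖v‖ₑ * (∫⁻ t, ‖η t‖ₑ) * ∫⁻ z in Metric.ball x R, ‖G z‖ₑ := by
  set u := η ⋆[ContinuousLinearMap.lsmul ℝ ℝ, volume] f with hu_def
  have hu : ContDiff ℝ 1 u :=
    hηc.contDiff_convolution_left _ (hη.of_le (by simp)) hG.locInt
  have hηm : Measurable η := hη.continuous.measurable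
  have hfd : ∀ y, ‖fderiv ℝ u y v‖ₑ ≤ ∫⁻ t, ‖v‖ₑ * (‖η t‖ₑ * ‖G (y - t)‖ₑ) := by
    intro y
    rw [hu_def, hG.fderiv_convolution hη hηc]
    refine (enorm_integral_le_lintegral_enorm _).trans (lintegral_mono fun t => ?_)
    rw [enorm_mul, mul_left_comm]
    gcongr
    have := norm_inner_le_norm (𝕜 := ℝ) v (G (y - t))
    rw [← enorm_norm v, ← enorm_norm (G (y - t)), ← enorm_mul]
    exact enorm_le_iff_norm_le.2 (by simpa using this)
  calc ∫⁻ z in Metric.ball x r, ‖u (z + v) - u z‖ₑ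
      ≤ ∫⁻ z in Metric.ball x r, ∫⁻ θ in Icc (0 : ℝ) 1, ∫⁻ t,
          ‖v‖ₑ * (‖η t‖ₑ * ‖G (z + θ • v - t)‖ₑ) := by
        refine lintegral_mono fun z => (enorm_add_sub_le_lintegral hu z v).trans ?_
        exact lintegral_mono fun θ => hfd _
    _ = ∫⁻ θ in Icc (0 : ℝ) 1, ∫⁻ z in Metric.ball x r, ∫⁻ t,
          ‖v‖ₑ * (‖η t‖ₑ * ‖G (z + θ • v - t)‖ₑ) := by
        refine lintegral_lintegral_swap (Measurable.aemeasurable ?_)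
        refine Measurable.lintegral_prod_right' (f := fun p : (Plane × ℝ) × Plane =>
          ‖v‖ₑ * (‖η p.2‖ₑ * ‖G (p.1.1 + p.1.2 • v - p.2)‖ₑ)) ?_
        fun_prop
    _ = ∫⁻ θ in Icc (0 : ℝ) 1, ∫⁻ t, ∫⁻ z in Metric.ball x r,
          ‖v‖ₑ * (‖η t‖ₑ * ‖G (z + θ • v - t)‖ₑ) := by
        congr with θ
        exact lintegral_lintegral_swap (Measurable.aemeasurable (by fun_prop))
    _ ≤ ∫⁻ θ in Icc (0 : ℝ) 1, ∫⁻ t, ‖v‖ₑ * (‖η t‖ₑ * ∫⁻ z in Metric.ball x R, ‖G z‖ₑ) := by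
        refine setLIntegral_mono' measurableSet_Icc fun θ hθ => lintegral_mono fun t => ?_
        rw [lintegral_const_mul _ (by fun_prop), lintegral_const_mul _ (by fun_prop)]
        by_cases ht : δ < ‖t‖
        · simp [hsupp t ht]
        refine mul_le_mul_right (mul_le_mul_right ?_ _) _
        simp only [add_sub_assoc _ (θ • v) t]
        refine lintegral_ball_comp_add_le (g := fun z => ‖G z‖ₑ) ?_
        have h1 : ‖θ • v - t‖ ≤ ‖θ • v‖ + ‖t‖ := norm_sub_le _ _
        have h2 : ‖θ • v‖ ≤ ‖v‖ := by
          rw [norm_smul, Real.norm_of_nonneg hθ.1]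
          exact mul_le_of_le_one_left (norm_nonneg _) hθ.2
        linarith [not_lt.1 ht]
    _ = ‖v‖ₑ * (∫⁻ t, ‖η t‖ₑ) * ∫⁻ z in Metric.ball x R, ‖G z‖ₑ := by
        rw [setLIntegral_const, lintegral_const_mul _ (by fun_prop),
          lintegral_mul_const _ (by fun_prop)]
        simp [mul_assoc]

theorem IsWeakGradient.congr_right {f : Plane → ℝ} {G G' : Plane → Plane}
    (hG : IsWeakGradient f G) (h : G =ᵐ[volume] G') : IsWeakGradient f G' where
  locInt := hG.locInt
  locInt_grad := hG.locInt_grad.congr h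
  integral_eq φ hφ := by
    rw [hG.integral_eq φ hφ]
    congr 1
    refine integral_congr_ae ?_
    filter_upwards [h] with y hy
    rw [hy]

/-- A function with a weak gradient varies under a translation by at most the length of the
translation times the integral of the gradient. -/
theorem IsWeakGradient.lintegral_translate_le {f : Plane → ℝ} {G : Plane → Plane}
    (hG : IsWeakGradient f G) {x v : Plane} {r R : ℝ} (hR : r + ‖v‖ < R) :
    ∫⁻ z in Metric.ball x r, ‖f (z + v) - f z‖ₑ ≤ ‖v‖ₑ * ∫⁻ z in Metric.ball x R, ‖G z‖ₑ := by
  wlog hGm : Measurable G generalizing G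
  · have hae := hG.locInt_grad.aestronglyMeasurable.ae_eq_mk
    have := this (hG.congr_right hae)
      hG.locInt_grad.aestronglyMeasurable.stronglyMeasurable_mk.measurable
    refine this.trans_eq ?_
    congr 1
    refine lintegral_congr_ae ?_
    filter_upwards [ae_restrict_of_ae hae] with y hy
    rw [hy]
  set d := R - (r + ‖v‖) with hd
  have hdpos : 0 < d := by rw [hd]; linarith
  -- The outer radii are at most the slack `d` and tend to `0`; the fixed ratio `2` of outer to
  -- inner radius is what almost everywhere convergence of the mollifications asks for.
  let φ : ℕ → ContDiffBump (0 : Plane) := fun n =>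
    ⟨d / (2 * (n + 1)), d / (n + 1), by positivity, by
      rw [div_lt_div_iff₀ (by positivity) (by positivity)]
      nlinarith [mul_pos hdpos (show (0 : ℝ) < n + 1 by positivity)]⟩
  let u : ℕ → Plane → ℝ := fun n =>
    (φ n).normed volume ⋆[ContinuousLinearMap.lsmul ℝ ℝ, volume] f
  have hlim : ∀ᵐ z, Tendsto (fun n => u n z) atTop (𝓝 (f z)) := by
    refine ContDiffBump.ae_convolution_tendsto_right_of_locallyIntegrable (K := 2) ?_ ?_ hG.locInt
    · exact tendsto_const_div_atTop_nhds_zero_nat d |>.comp (tendsto_add_atTop_nat 1) |>.congr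
        fun n => by simp [φ]
    · refine Eventually.of_forall fun n => le_of_eq ?_
      simp only [φ]; field_simp
  have hlim' : ∀ᵐ z, Tendsto (fun n => u n (z + v)) atTop (𝓝 (f (z + v))) :=
    (measurePreserving_add_right (volume : Measure Plane) v).quasiMeasurePreserving.ae hlim
  have hcont : ∀ n, Continuous (u n) := fun n =>
    (HasCompactSupport.contDiff_convolution_left (n := 0) _
      ((φ n).hasCompactSupport_normed (μ := volume))
      ((φ n).contDiff_normed (n := 0)) hG.locInt).continuous
  -- Fatou's lemma carries the uniform bound for the mollifications over to `f`.
  calc ∫⁻ z in Metric.ball x r, ‖f (z + v) - f z‖ₑ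
      = ∫⁻ z in Metric.ball x r, liminf (fun n => ‖u n (z + v) - u n z‖ₑ) atTop := by
        refine lintegral_congr_ae (ae_restrict_of_ae ?_)
        filter_upwards [hlim, hlim'] with z h1 h2
        exact ((h2.sub h1).enorm.liminf_eq).symm
    _ ≤ liminf (fun n => ∫⁻ z in Metric.ball x r, ‖u n (z + v) - u n z‖ₑ) atTop :=
        lintegral_liminf_le fun n => by have := hcont n; fun_prop
    _ ≤ liminf (fun _ : ℕ => ‖v‖ₑ * ∫⁻ z in Metric.ball x R, ‖G z‖ₑ) atTop := by
        refine liminf_le_liminf (Eventually.of_forall fun n => ?_)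
        have h1 : ∫⁻ t, ‖(φ n).normed volume t‖ₑ = 1 := by
          rw [← ofReal_integral_norm_eq_lintegral_enorm ((φ n).integrable_normed (μ := volume))]
          simp_rw [Real.norm_of_nonneg ((φ n).nonneg_normed _)]
          rw [(φ n).integral_normed]
          simp
        have := hG.lintegral_translate_convolution_le hGm ((φ n).contDiff_normed (μ := volume))
          (φ n).hasCompactSupport_normed (x := x) (v := v) (r := r) (R := R) (δ := d)
          (fun t ht => ?_) (by rw [hd]; linarith)
        · rwa [h1, mul_one] at this
        · have : t ∉ Function.support ((φ n).normed volume) := by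
            rw [(φ n).support_normed_eq (μ := volume), Metric.mem_ball, dist_zero_right, not_lt]
            refine le_trans ?_ ht.le
            exact div_le_self hdpos.le (by simp)
          simpa using this
    _ = _ := liminf_const _

/-! ### Poincaré inequality on balls -/

theorem IsWeakGradient.congr_left {f f' : Plane → ℝ} {G : Plane → Plane}
    (hG : IsWeakGradient f G) (h : f =ᵐ[volume] f') : IsWeakGradient f' G where
  locInt := hG.locInt.congr h
  locInt_grad := hG.locInt_grad
  integral_eq φ hφ := by
    rw [← hG.integral_eq φ hφ]
    refine integral_congr_ae ?_
    filter_upwards [h] with y hy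
    rw [hy]

/-- Substitute `w = z + v`: two points of a ball of radius `r` differ by less than `2r`. This
reduces the Poincaré inequality to the translation estimate. -/
theorem lintegral_ball_le_lintegral_translate {f : Plane → ℝ} {x z : Plane} {r : ℝ}
    (hz : z ∈ Metric.ball x r) :
    ∫⁻ w in Metric.ball x r, ‖f z - f w‖ₑ
      ≤ ∫⁻ v in Metric.ball (0 : Plane) (2 * r), ‖f (z + v) - f z‖ₑ := by
  have hmp := measurePreserving_add_left (volume : Measure Plane) z
  have he : MeasurableEmbedding (fun v : Plane => z + v) := measurableEmbedding_addLeft z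
  rw [← hmp.setLIntegral_comp_preimage_emb he]
  simp only [enorm_sub_rev (f z)]
  refine lintegral_mono_set fun v hv => ?_
  simp only [mem_preimage, Metric.mem_ball, dist_zero_right] at hv hz ⊢
  calc ‖v‖ = dist (z + v) z := by simp [dist_eq_norm]
    _ ≤ dist (z + v) x + dist x z := dist_triangle _ _ _
    _ < 2 * r := by rw [dist_comm x z]; linarith

/-- A Poincaré inequality on balls. -/
theorem IsWeakGradient.lintegral_lintegral_ball_le {f : Plane → ℝ} {G : Plane → Plane}
    (hG : IsWeakGradient f G) (x : Plane) {r : ℝ} (hr : 0 < r) :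
    ∫⁻ z in Metric.ball x r, ∫⁻ w in Metric.ball x r, ‖f z - f w‖ₑ
      ≤ ENNReal.ofReal (2 * r) * volume (Metric.ball (0 : Plane) (2 * r))
        * ∫⁻ z in Metric.ball x (4 * r), ‖G z‖ₑ := by
  wlog hfm : Measurable f generalizing f
  · have hae := hG.locInt.aestronglyMeasurable.ae_eq_mk
    have := this (hG.congr_left hae)
      hG.locInt.aestronglyMeasurable.stronglyMeasurable_mk.measurable
    refine le_trans (le_of_eq ?_) this
    refine lintegral_congr_ae ?_
    filter_upwards [ae_restrict_of_ae hae] with z hz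
    refine lintegral_congr_ae ?_
    filter_upwards [ae_restrict_of_ae hae] with w hw
    rw [hz, hw]
  calc ∫⁻ z in Metric.ball x r, ∫⁻ w in Metric.ball x r, ‖f z - f w‖ₑ
      ≤ ∫⁻ z in Metric.ball x r, ∫⁻ v in Metric.ball (0 : Plane) (2 * r), ‖f (z + v) - f z‖ₑ :=
        setLIntegral_mono' measurableSet_ball fun z hz => lintegral_ball_le_lintegral_translate hz
    _ = ∫⁻ v in Metric.ball (0 : Plane) (2 * r), ∫⁻ z in Metric.ball x r, ‖f (z + v) - f z‖ₑ :=
        lintegral_lintegral_swap (Measurable.aemeasurable (by fun_prop))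
    _ ≤ ∫⁻ v in Metric.ball (0 : Plane) (2 * r),
          ENNReal.ofReal (2 * r) * ∫⁻ z in Metric.ball x (4 * r), ‖G z‖ₑ := by
        refine setLIntegral_mono' measurableSet_ball fun v hv => ?_
        rw [mem_ball_zero_iff] at hv
        refine (hG.lintegral_translate_le (R := 4 * r) (by linarith)).trans ?_
        refine mul_le_mul_left ?_ _
        rw [← ofReal_norm]
        exact ENNReal.ofReal_le_ofReal hv.le
    _ = _ := by rw [setLIntegral_const]; ring

/-! ### Energy and oscillation of means -/

/-- The energy of a vector field, as a measure. -/
noncomputable def energyMeasure (G : Plane → Plane) : Measure Plane :=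
  volume.withDensity fun z => ‖G z‖ₑ ^ 2

theorem isFiniteMeasure_energyMeasure {G : Plane → Plane} (hG : MemLp G 2) :
    IsFiniteMeasure (energyMeasure G) := by
  refine isFiniteMeasure_withDensity ?_
  have h := lintegral_rpow_enorm_lt_top_of_eLpNorm_lt_top (by simp) (by simp) hG.eLpNorm_lt_top
  simpa using h.ne

theorem tendsto_energyMeasure_ball {G : Plane → Plane} (hG : MemLp G 2) (x : Plane) (c : ℝ) :
    Tendsto (fun r => (energyMeasure G).real (Metric.ball x (c * r))) (𝓝[>] 0) (𝓝 0) := by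
  have hfin : ∫⁻ z, ‖G z‖ₑ ^ 2 ≠ ⊤ := by
    have h := lintegral_rpow_enorm_lt_top_of_eLpNorm_lt_top (by simp) (by simp) hG.eLpNorm_lt_top
    simpa using h.ne
  have hvol : Tendsto (fun r : ℝ => volume (Metric.ball x (c * r))) (𝓝[>] 0) (𝓝 0) := by
    have h0 : Tendsto (fun r : ℝ => ENNReal.ofReal (c * r) ^ 2 * ENNReal.ofReal Real.pi)
        (𝓝 0) (𝓝 (ENNReal.ofReal (c * 0) ^ 2 * ENNReal.ofReal Real.pi)) := by
      refine ENNReal.Tendsto.mul_const ?_ (Or.inr ENNReal.ofReal_ne_top)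
      refine ENNReal.Tendsto.pow (ENNReal.tendsto_ofReal ?_)
      exact (continuous_const.mul continuous_id).tendsto _
    simp only [mul_zero, ENNReal.ofReal_zero, ne_eq, OfNat.ofNat_ne_zero, not_false_eq_true,
      zero_pow, zero_mul] at h0
    simpa only [EuclideanSpace.volume_ball_fin_two] using h0.mono_left nhdsWithin_le_nhds
  have h := tendsto_setLIntegral_zero hfin hvol
  have h2 := (ENNReal.tendsto_toReal ENNReal.zero_ne_top).comp h
  simp only [ENNReal.toReal_zero] at h2
  refine h2.congr fun r => ?_
  simp [Measure.real, energyMeasure, withDensity_apply _ measurableSet_ball]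

/-- Cauchy–Schwarz against the constant `1`, with `√π` rounded up to `2`. -/
theorem lintegral_ball_enorm_le {G : Plane → Plane} (hG : MemLp G 2) (x : Plane) {r : ℝ}
    (hr : 0 < r) :
    ∫⁻ z in Metric.ball x r, ‖G z‖ₑ
      ≤ ENNReal.ofReal (2 * r * √((energyMeasure G).real (Metric.ball x r))) := by
  have := isFiniteMeasure_energyMeasure hG
  have h := ENNReal.lintegral_mul_le_Lp_mul_Lq (volume.restrict (Metric.ball x r))
    Real.HolderConjugate.two_two (f := fun _ => 1) (g := fun z => ‖G z‖ₑ) aemeasurable_const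
    hG.aestronglyMeasurable.enorm.restrict
  have hE : ∫⁻ z in Metric.ball x r, ‖G z‖ₑ ^ (2 : ℝ)
      = ENNReal.ofReal ((energyMeasure G).real (Metric.ball x r)) := by
    rw [Measure.real, ENNReal.ofReal_toReal (measure_ne_top _ _), energyMeasure,
      withDensity_apply _ measurableSet_ball]
    simp
  simp only [Pi.mul_apply, one_mul, ENNReal.one_rpow, setLIntegral_const,
    EuclideanSpace.volume_ball_fin_two, hE] at h
  refine h.trans ?_
  rw [← ENNReal.ofReal_pow hr.le, ← ENNReal.ofReal_mul (by positivity),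
    ENNReal.ofReal_rpow_of_nonneg (by positivity) (by norm_num),
    ENNReal.ofReal_rpow_of_nonneg (by positivity) (by norm_num),
    ← ENNReal.ofReal_mul (by positivity)]
  refine ENNReal.ofReal_le_ofReal ?_
  rw [← Real.sqrt_eq_rpow, ← Real.sqrt_eq_rpow]
  gcongr
  rw [Real.sqrt_le_left (by positivity)]
  nlinarith [Real.pi_lt_four, sq_nonneg r]

/-- The mean of `f` on a ball. -/
noncomputable def ballMean (f : Plane → ℝ) (x : Plane) (r : ℝ) : ℝ := ⨍ y in Metric.ball x r, f y

theorem volumeReal_ball {x : Plane} {r : ℝ} (hr : 0 < r) :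
    volume.real (Metric.ball x r) = Real.pi * r ^ 2 := by
  rw [Measure.real, EuclideanSpace.volume_ball_fin_two]
  simp [ENNReal.toReal_ofReal hr.le, Real.pi_nonneg, mul_comm]

theorem volume_ball_eq_ofReal {x : Plane} {r : ℝ} (hr : 0 < r) :
    volume (Metric.ball x r) = ENNReal.ofReal (Real.pi * r ^ 2) := by
  rw [← volumeReal_ball (x := x) hr, Measure.real, ENNReal.ofReal_toReal]
  exact measure_ball_lt_top.ne

theorem integrableOn_ball {f : Plane → ℝ} (hf : LocallyIntegrable f) (x : Plane) (r : ℝ) :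
    IntegrableOn f (Metric.ball x r) :=
  (hf.integrableOn_isCompact (isCompact_closedBall x r)).mono_set Metric.ball_subset_closedBall

theorem ofReal_abs_sub_ballMean_le {f : Plane → ℝ} (hf : LocallyIntegrable f) (a : ℝ) (y : Plane)
    {s : ℝ} (hs : 0 < s) :
    ENNReal.ofReal |a - ballMean f y s|
      ≤ ENNReal.ofReal (Real.pi * s ^ 2)⁻¹ * ∫⁻ w in Metric.ball y s, ‖a - f w‖ₑ := by
  have hi := integrableOn_ball hf y s
  have hv : volume.real (Metric.ball y s) ≠ 0 := by rw [volumeReal_ball hs]; positivity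
  have hfin : volume (Metric.ball y s) ≠ ⊤ := measure_ball_lt_top.ne
  have hc : Integrable (fun _ : Plane => a) (volume.restrict (Metric.ball y s)) :=
    integrableOn_const hfin
  have h1 : a - ballMean f y s
      = (Real.pi * s ^ 2)⁻¹ * ∫ w in Metric.ball y s, (a - f w) := by
    rw [integral_sub hc hi, setIntegral_const, ballMean, setAverage_eq,
      ← volumeReal_ball (x := y) hs, smul_eq_mul, smul_eq_mul]
    field_simp
  rw [h1, abs_mul, abs_of_nonneg (by positivity), ENNReal.ofReal_mul (by positivity)]
  gcongr
  rw [← Real.norm_eq_abs, ofReal_norm]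
  exact enorm_integral_le_lintegral_enorm _

/-- Both averages are bounded by the double integral over `B_r(x)`, to which Poincaré and
Cauchy–Schwarz apply. All powers of the radius cancel up to the ratio `r / s ≤ 2`; this is where
dimension two and exponent two match. -/
theorem IsWeakGradient.setAverage_abs_sub_ballMean_le {f : Plane → ℝ} {G : Plane → Plane}
    (hG : IsWeakGradient f G) (hG2 : MemLp G 2) {x y : Plane} {r s : ℝ} (hs : 0 < s)
    (hr : 0 < r) (hrs : r ≤ 2 * s) (hsub : Metric.ball y s ⊆ Metric.ball x r) :
    ⨍ z in Metric.ball x r, |f z - ballMean f y s|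
      ≤ 100 * √((energyMeasure G).real (Metric.ball x (4 * r))) := by
  set E := (energyMeasure G).real (Metric.ball x (4 * r)) with hE
  have hi : IntegrableOn (fun z => f z - ballMean f y s) (Metric.ball x r) :=
    (integrableOn_ball hG.locInt x r).sub (integrableOn_const measure_ball_lt_top.ne)
  rw [setAverage_eq, volumeReal_ball hr, smul_eq_mul, ← ENNReal.ofReal_le_ofReal_iff (by positivity),
    ENNReal.ofReal_mul (by positivity)]
  have hI : ENNReal.ofReal (∫ z in Metric.ball x r, |f z - ballMean f y s|)
      = ∫⁻ z in Metric.ball x r, ENNReal.ofReal |f z - ballMean f y s| := by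
    rw [← ofReal_integral_eq_lintegral_ofReal hi.abs (by filter_upwards; simp)]
  have hP := hG.lintegral_lintegral_ball_le x hr
  rw [volume_ball_eq_ofReal (by positivity), ← ENNReal.ofReal_mul (by positivity)] at hP
  calc ENNReal.ofReal (Real.pi * r ^ 2)⁻¹
        * ENNReal.ofReal (∫ z in Metric.ball x r, |f z - ballMean f y s|)
      ≤ ENNReal.ofReal (Real.pi * r ^ 2)⁻¹ * ∫⁻ z in Metric.ball x r,
          ENNReal.ofReal (Real.pi * s ^ 2)⁻¹ * ∫⁻ w in Metric.ball x r, ‖f z - f w‖ₑ := by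
        rw [hI]
        gcongr with z
        refine (ofReal_abs_sub_ballMean_le hG.locInt (f z) y hs).trans ?_
        gcongr
    _ = ENNReal.ofReal (Real.pi * r ^ 2)⁻¹ * (ENNReal.ofReal (Real.pi * s ^ 2)⁻¹ *
          ∫⁻ z in Metric.ball x r, ∫⁻ w in Metric.ball x r, ‖f z - f w‖ₑ) := by
        rw [lintegral_const_mul' _ _ ENNReal.ofReal_ne_top]
    _ ≤ ENNReal.ofReal (Real.pi * r ^ 2)⁻¹ * (ENNReal.ofReal (Real.pi * s ^ 2)⁻¹ *
          (ENNReal.ofReal (2 * r * (Real.pi * (2 * r) ^ 2))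
            * ENNReal.ofReal (2 * (4 * r) * √E))) := by
        gcongr
        refine hP.trans ?_
        gcongr
        exact lintegral_ball_enorm_le hG2 x (by positivity)
    _ ≤ ENNReal.ofReal (100 * √E) := by
        rw [← ENNReal.ofReal_mul (by positivity), ← ENNReal.ofReal_mul (by positivity),
          ← ENNReal.ofReal_mul (by positivity)]
        refine ENNReal.ofReal_le_ofReal ?_
        -- The constant is `64 r² / (π s²) ≤ 256 / π`, below `100` because `π > 3`.
        have hpi := Real.pi_gt_three
        have h1 : (Real.pi * r ^ 2)⁻¹ * ((Real.pi * s ^ 2)⁻¹ *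
            (2 * r * (Real.pi * (2 * r) ^ 2) * (2 * (4 * r) * √E)))
            = (64 * r ^ 2 / (Real.pi * s ^ 2)) * √E := by
          field_simp; ring
        rw [h1]
        gcongr
        rw [div_le_iff₀ (by positivity)]
        have : r ^ 2 ≤ (2 * s) ^ 2 := by gcongr
        nlinarith [sq_nonneg s]

theorem abs_ballMean_sub_le {f : Plane → ℝ} (hf : LocallyIntegrable f) {x : Plane} {r : ℝ}
    (hr : 0 < r) (c : ℝ) : |ballMean f x r - c| ≤ ⨍ z in Metric.ball x r, |f z - c| := by
  have hfin : volume (Metric.ball x r) ≠ ⊤ := measure_ball_lt_top.ne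
  have hc : Integrable (fun _ : Plane => c) (volume.restrict (Metric.ball x r)) :=
    integrableOn_const hfin
  have hv := volumeReal_ball (x := x) hr
  have h : ballMean f x r - c = ⨍ z in Metric.ball x r, (f z - c) := by
    rw [ballMean, setAverage_eq, setAverage_eq, integral_sub (integrableOn_ball hf x r) hc,
      setIntegral_const, hv, smul_eq_mul, smul_eq_mul, smul_eq_mul]
    field_simp
  rw [h, setAverage_eq, setAverage_eq, hv, smul_eq_mul, smul_eq_mul, abs_mul,
    abs_of_nonneg (by positivity)]
  gcongr
  exact abs_integral_le_integral_abs

theorem setAverage_abs_sub_le {f : Plane → ℝ} (hf : LocallyIntegrable f) {x : Plane} {r : ℝ}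
    (hr : 0 < r) (c d : ℝ) :
    ⨍ z in Metric.ball x r, |f z - d| ≤ (⨍ z in Metric.ball x r, |f z - c|) + |c - d| := by
  have hc : ∀ c : ℝ, Integrable (fun _ : Plane => c) (volume.restrict (Metric.ball x r)) :=
    fun c => integrableOn_const measure_ball_lt_top.ne
  have hi : ∀ c, Integrable (fun z => |f z - c|) (volume.restrict (Metric.ball x r)) :=
    fun c => ((integrableOn_ball hf x r).sub (hc c)).abs
  have hv := volumeReal_ball (x := x) hr
  have h : ∫ z in Metric.ball x r, |f z - d|
      ≤ ∫ z in Metric.ball x r, (|f z - c| + |c - d|) :=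
    integral_mono (hi d) ((hi c).add (hc _)) fun z => abs_sub_le _ _ _
  rw [integral_add (hi c) (hc _), setIntegral_const, hv, smul_eq_mul] at h
  rw [setAverage_eq, setAverage_eq, hv, smul_eq_mul, smul_eq_mul]
  calc _ ≤ (Real.pi * r ^ 2)⁻¹
        * ((∫ z in Metric.ball x r, |f z - c|) + Real.pi * r ^ 2 * |c - d|) := by
        gcongr
    _ = _ := by field_simp

/-! ### Convergence of means at points of linear energy growth -/

/-- The energy growth condition `∫_{B_t(y)} |G|² ≤ M t` for `t ≤ T`. -/
def EnergyGrowth (G : Plane → Plane) (y : Plane) (M T : ℝ) : Prop :=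
  ∀ t, 0 < t → t ≤ T → (energyMeasure G).real (Metric.ball y t) ≤ M * t

theorem EnergyGrowth.mono {G : Plane → Plane} {y : Plane} {M T T' : ℝ} (h : EnergyGrowth G y M T)
    (hT : T' ≤ T) : EnergyGrowth G y M T' := fun t ht htT => h t ht (htT.trans hT)

/-- Dyadic telescoping: halving the radius from `r` costs at most `200 √(M r)`, and these costs
decay geometrically. The growth condition reaches up to `4r` because the Poincaré estimate uses the
enlarged ball. -/
theorem EnergyGrowth.abs_ballMean_sub_le {f : Plane → ℝ} {G : Plane → Plane} {y : Plane}
    {M r s : ℝ} (hG : IsWeakGradient f G) (hG2 : MemLp G 2) (h : EnergyGrowth G y M (4 * r))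
    (hs : 0 < s) (hsr : s ≤ r) : |ballMean f y s - ballMean f y r| ≤ 800 * √(M * r) := by
  have key : ∀ r s : ℝ, 0 < s → s ≤ r → r ≤ 2 * s → EnergyGrowth G y M (4 * r) →
      |ballMean f y s - ballMean f y r| ≤ 200 * √(M * r) := by
    intro r s hs hsr hrs hM
    have hr : 0 < r := hs.trans_le hsr
    rw [abs_sub_comm]
    refine (_root_.abs_ballMean_sub_le hG.locInt hr _).trans
      ((hG.setAverage_abs_sub_ballMean_le hG2 hs hr hrs (Metric.ball_subset_ball hsr)).trans ?_)
    have h4 : √(M * (4 * r)) = 2 * √(M * r) := by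
      rw [show M * (4 * r) = 2 ^ 2 * (M * r) by ring, Real.sqrt_mul (by norm_num),
        Real.sqrt_sq (by norm_num)]
    calc _ ≤ 100 * √(M * (4 * r)) := by
          gcongr
          exact hM _ (by positivity) le_rfl
      _ = _ := by rw [h4]; ring
  have hr : 0 < r := hs.trans_le hsr
  obtain ⟨n, hn⟩ := pow_unbounded_of_one_lt (r / s) (one_lt_two (α := ℝ))
  rw [div_lt_iff₀ hs] at hn
  induction n generalizing r with
  | zero => simp at hn; linarith
  | succ n ih =>
    by_cases hcase : r ≤ 2 * s
    · refine (key r s hs hsr hcase h).trans ?_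
      gcongr; norm_num
    push Not at hcase
    have h1 := ih (r := r / 2) (h.mono (by linarith)) (by linarith) (by linarith)
      (by rw [pow_succ] at hn; linarith)
    have h2 := key r (r / 2) (by linarith) (by linarith) (by linarith) h
    -- Since `√(1/2) ≤ 3/4`, the induction closes exactly: `800 · 3/4 + 200 = 800`.
    have h3 : √(M * (r / 2)) ≤ 3 / 4 * √(M * r) := by
      rw [show M * (r / 2) = (1 / 2) * (M * r) by ring, Real.sqrt_mul (by norm_num)]
      gcongr
      rw [Real.sqrt_le_left (by norm_num)]
      norm_num
    calc _ ≤ |ballMean f y s - ballMean f y (r / 2)| + |ballMean f y (r / 2) - ballMean f y r| :=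
          abs_sub_le _ _ _
      _ ≤ 800 * √(M * (r / 2)) + 200 * √(M * r) := add_le_add h1 h2
      _ ≤ _ := by linarith

theorem preciseRep_eq_of_tendsto {f : Plane → ℝ} {x : Plane} {c : ℝ}
    (h : Tendsto (fun r : ℝ => ballMean f x r) (𝓝[>] 0) (𝓝 c)) : preciseRep f x = c := by
  have hx : ∃ c : ℝ, Tendsto (fun r : ℝ => ⨍ y in Metric.ball x r, f y) (𝓝[>] 0) (𝓝 c) := ⟨c, h⟩
  rw [preciseRep, dif_pos hx]
  exact tendsto_nhds_unique (Classical.choose_spec hx) h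

/-- At points where the energy grows at most linearly the means over balls converge to the precise
representative, with a rate. -/
theorem EnergyGrowth.abs_ballMean_sub_preciseRep_le {f : Plane → ℝ} {G : Plane → Plane} {y : Plane}
    {M r : ℝ} (hG : IsWeakGradient f G) (hG2 : MemLp G 2) (h : EnergyGrowth G y M (4 * r))
    (hr : 0 < r) : |ballMean f y r - preciseRep f y| ≤ 800 * √(M * r) := by
  have hcauchy : Cauchy (map (fun s => ballMean f y s) (𝓝[>] (0 : ℝ))) := by
    rw [Metric.cauchy_iff]
    refine ⟨inferInstance, fun ε hε => ?_⟩
    have hlim : Tendsto (fun t : ℝ => 800 * √(M * t)) (𝓝[>] 0) (𝓝 0) := by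
      have : Continuous fun t : ℝ => 800 * √(M * t) := by fun_prop
      simpa using (this.tendsto 0).mono_left (nhdsWithin_le_nhds (s := Ioi 0))
    obtain ⟨t, ht1, ht2, ht3⟩ := ((hlim.eventually (gt_mem_nhds (half_pos hε))).and
      (Ioc_mem_nhdsGT hr)).exists
    refine ⟨_, image_mem_map (Ioc_mem_nhdsGT ht2), ?_⟩
    rintro _ ⟨a, ha, rfl⟩ _ ⟨b, hb, rfl⟩
    have h1 := EnergyGrowth.abs_ballMean_sub_le hG hG2 (h.mono (T' := 4 * t) (by linarith))
      ha.1 ha.2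
    have h2 := EnergyGrowth.abs_ballMean_sub_le hG hG2 (h.mono (T' := 4 * t) (by linarith))
      hb.1 hb.2
    rw [Real.dist_eq]
    rw [abs_sub_comm] at h2
    calc _ ≤ _ := abs_sub_le _ (ballMean f y t) _
      _ < ε := by linarith
  obtain ⟨c, hc⟩ := CompleteSpace.complete hcauchy
  replace hc : Tendsto (fun s => ballMean f y s) (𝓝[>] 0) (𝓝 c) := hc
  rw [preciseRep_eq_of_tendsto hc, abs_sub_comm]
  refine le_of_tendsto ((hc.sub tendsto_const_nhds).abs) ?_
  filter_upwards [Ioc_mem_nhdsGT hr] with s hs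
  exact EnergyGrowth.abs_ballMean_sub_le hG hG2 h hs.1 hs.2

/-! ### Good points on a connected set, by a Vitali covering -/

/-- If every point of `A` is the centre of a ball on which the finite measure `ν` is large compared
to the radius, then the distances from the points of `A` to `x` form a small set. -/
theorem volume_image_dist_le_of_large_balls {ν : Measure Plane} [IsFiniteMeasure ν]
    {A U : Set Plane} {x : Plane} {M T : ℝ} (hM : 0 < M)
    (hA : ∀ y ∈ A, ∃ t, 0 < t ∧ t ≤ T ∧ Metric.closedBall y t ⊆ U ∧
      M * t ≤ ν.real (Metric.ball y t)) :
    volume ((fun y => dist y x) '' A) ≤ ENNReal.ofReal (10 / M) * ν U := by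
  choose! t ht0 htT htU htM using hA
  obtain ⟨u, huA, hdisj, hcov⟩ := Vitali.exists_disjoint_subfamily_covering_enlargement_closedBall
    A id t T htT 5 (by norm_num)
  replace hdisj : u.PairwiseDisjoint fun a => Metric.closedBall a (t a) := hdisj
  have hcount : u.Countable := by
    refine hdisj.countable_of_nonempty_interior fun y hy => ⟨y, ?_⟩
    exact Metric.ball_subset_interior_closedBall (Metric.mem_ball_self (ht0 y (huA hy)))
  have hsub : (fun y => dist y x) '' A
      ⊆ ⋃ b ∈ u, Metric.closedBall (dist b x) (5 * t b) := by
    rintro _ ⟨y, hy, rfl⟩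
    obtain ⟨b, hb, hyb⟩ := hcov y hy
    refine mem_biUnion hb ?_
    have h1 : y ∈ Metric.closedBall b (5 * t b) := hyb (Metric.mem_closedBall_self (ht0 y hy).le)
    rw [Metric.mem_closedBall] at h1 ⊢
    exact (abs_dist_sub_le y b x).trans h1
  calc volume ((fun y => dist y x) '' A)
      ≤ ∑' b : u, volume (Metric.closedBall (dist (b : Plane) x) (5 * t b)) :=
        (measure_mono hsub).trans (measure_biUnion_le _ hcount _)
    _ ≤ ∑' b : u, ENNReal.ofReal (10 / M) * ν (Metric.closedBall (b : Plane) (t b)) := by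
        refine ENNReal.tsum_le_tsum fun b => ?_
        -- The fivefold enlargement of a ball of radius `t b` projects into an interval of length
        -- `10 t b`, hence the factor `10 / M`.
        rw [Real.volume_closedBall]
        have hb := huA b.2
        calc ENNReal.ofReal (2 * (5 * t b))
            ≤ ENNReal.ofReal (10 / M * ν.real (Metric.ball (b : Plane) (t b))) := by
              refine ENNReal.ofReal_le_ofReal ?_
              rw [div_mul_eq_mul_div, le_div_iff₀ hM]
              linarith [htM b hb]
          _ = ENNReal.ofReal (10 / M) * ν (Metric.ball (b : Plane) (t b)) := by
              rw [ENNReal.ofReal_mul (by positivity), Measure.real,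
                ENNReal.ofReal_toReal (measure_ne_top _ _)]
          _ ≤ _ := by gcongr; exact Metric.ball_subset_closedBall
    _ = ENNReal.ofReal (10 / M) * ∑' b : u, ν (Metric.closedBall (b : Plane) (t b)) :=
        ENNReal.tsum_mul_left
    _ = ENNReal.ofReal (10 / M) * ν (⋃ b ∈ u, Metric.closedBall b (t b)) := by
        rw [measure_biUnion hcount hdisj fun _ _ => measurableSet_closedBall]
    _ ≤ _ := by
        gcongr
        exact iUnion₂_subset fun b hb => htU b (huA hb)

/-- The distance to `x` is 1-Lipschitz, and `ℋ¹` on the line is Lebesgue measure. Hence the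
exceptional set where `f ≠ h` does not affect the count of distances. -/
theorem volume_image_dist_eq_zero {Z : Set Plane} (hZ : μH[1] Z = 0) (x : Plane) :
    volume ((fun y => dist y x) '' Z) = 0 := by
  have hl : LipschitzWith 1 fun y : Plane => dist y x := LipschitzWith.dist_left x
  have h := hl.hausdorffMeasure_image_le (d := 1) zero_le_one Z
  rw [hZ, hausdorffMeasure_real] at h
  simpa using h

theorem IsConnected.Ioo_subset_image_dist {C : Set Plane} (hC : IsConnected C) {x a : Plane}
    (hx : x ∈ closure C) (ha : a ∈ C) : Ioo 0 (dist a x) ⊆ (fun y => dist y x) '' C := by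
  rintro ρ ⟨h0, h1⟩
  obtain ⟨b, hb, hbx⟩ := Metric.mem_closure_iff.1 hx ρ h0
  rw [dist_comm] at hbx
  have hcont : ContinuousOn (fun y : Plane => dist y x) C := by fun_prop
  exact hC.isPreconnected.intermediate_value hb ha hcont ⟨hbx.le, h1.le⟩

/-- If every candidate point failed the growth condition, their distances to `x` would have measure
at most `r / 4` by the covering estimate. By connectedness these distances exhaust `(0, r / 2)` up
to a null set. -/
theorem exists_energyGrowth_of_isConnected {f : Plane → ℝ} {G : Plane → Plane} (hG2 : MemLp G 2)
    {C : Set Plane} (hC : IsConnected C) {h : ℝ}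
    (hfC : ∀ᵐ x ∂(μH[1] : Measure Plane), x ∈ C → f x = h) {x a : Plane} (hx : x ∈ closure C)
    (ha : a ∈ C) {r : ℝ} (hr : 0 < r) (hra : r ≤ dist a x) :
    ∃ y ∈ C, f y = h ∧ dist y x < r / 2 ∧ EnergyGrowth G y
      (40 * ((energyMeasure G).real (Metric.ball x (4 * r)) + r) / r) (4 * (r / 2)) := by
  have := isFiniteMeasure_energyMeasure hG2
  by_contra! hcon
  set ε := (energyMeasure G).real (Metric.ball x (4 * r)) with hε
  have hε0 : 0 ≤ ε := measureReal_nonneg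
  -- With this choice `10 / M * ε = (r / 4) * (ε / (ε + r)) ≤ r / 4`, while `M * (r / 2) = 20 * (ε +
  -- r)` still tends to `0`. The summand `r` keeps `M` positive when the energy vanishes.
  set M := 40 * (ε + r) / r with hMdef
  have hM : 0 < M := by positivity
  set A := {y | y ∈ C ∧ f y = h ∧ dist y x < r / 2} with hAdef
  set Z := {y | ¬ (y ∈ C → f y = h)} with hZdef
  have hZ : volume ((fun y => dist y x) '' Z) = 0 := volume_image_dist_eq_zero hfC x
  have hAv : volume ((fun y => dist y x) '' A)
      ≤ ENNReal.ofReal (10 / M) * energyMeasure G (Metric.ball x (4 * r)) := by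
    refine volume_image_dist_le_of_large_balls (T := 2 * r) hM fun y ⟨hyC, hyh, hyd⟩ => ?_
    have h1 := hcon y hyC hyh hyd
    simp only [EnergyGrowth, not_forall, not_le] at h1
    obtain ⟨t, ht0, htT, ht⟩ := h1
    refine ⟨t, ht0, by linarith, Metric.closedBall_subset_ball' (by linarith), ht.le⟩
  have hcover : Ioo 0 (r / 2) ⊆ (fun y => dist y x) '' A ∪ (fun y => dist y x) '' Z := by
    rintro ρ ⟨h0, h1⟩
    obtain ⟨y, hy, rfl⟩ := hC.Ioo_subset_image_dist hx ha ⟨h0, by linarith⟩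
    by_cases hyh : f y = h
    · exact Or.inl ⟨y, ⟨hy, hyh, h1⟩, rfl⟩
    · exact Or.inr ⟨y, by simp [hZdef, hy, hyh], rfl⟩
  have hle : ENNReal.ofReal (r / 2) ≤ ENNReal.ofReal (10 / M * ε) := by
    calc ENNReal.ofReal (r / 2) = volume (Ioo 0 (r / 2)) := by simp
      _ ≤ volume ((fun y => dist y x) '' A) + volume ((fun y => dist y x) '' Z) :=
          (measure_mono hcover).trans (measure_union_le _ _)
      _ ≤ ENNReal.ofReal (10 / M) * energyMeasure G (Metric.ball x (4 * r)) := by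
          rw [hZ, add_zero]; exact hAv
      _ = _ := by
          rw [ENNReal.ofReal_mul (by positivity), hε, Measure.real,
            ENNReal.ofReal_toReal (measure_ne_top _ _)]
  rw [ENNReal.ofReal_le_ofReal_iff (by positivity), hMdef] at hle
  have h2 : 10 / (40 * (ε + r) / r) * ε = r / 4 * (ε / (ε + r)) := by field_simp; ring
  have h3 : ε / (ε + r) ≤ 1 := by rw [div_le_one (by positivity)]; linarith
  rw [h2] at hle
  nlinarith

/-- A Sobolev function that is constant `ℋ¹`-a.e. on a connected set has that value as its limit
of means at every point of the closure. -/
theorem tendsto_setAverage_of_isConnected {f : Plane → ℝ} (hf : MemW12 f)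
    (hprec : f = preciseRep f) {C : Set Plane} (hC : IsConnected C) (hdiam : 0 < Metric.ediam C)
    {h : ℝ} (hfC : ∀ᵐ x ∂(μH[1] : Measure Plane), x ∈ C → f x = h) {x : Plane}
    (hx : x ∈ closure C) :
    Tendsto (fun r : ℝ => ⨍ y in Metric.ball x r, |f y - h|) (𝓝[>] 0) (𝓝 0) := by
  obtain ⟨-, G, hG2, hG⟩ := hf
  -- Its distance to `x` bounds the radii at which good points can be found.
  obtain ⟨a, ha, hax⟩ : ∃ a ∈ C, a ≠ x := by
    obtain ⟨a, ha, b, hb, hab⟩ := Metric.ediam_pos_iff.1 hdiam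
    by_cases hax : a = x
    · exact ⟨b, hb, fun hbx => hab (hax.trans hbx.symm)⟩
    · exact ⟨a, ha, hax⟩
  set ε : ℝ → ℝ := fun r => (energyMeasure G).real (Metric.ball x (4 * r)) with hε
  have hε0 : Tendsto ε (𝓝[>] 0) (𝓝 0) := tendsto_energyMeasure_ball hG2 x 4
  have hid : Tendsto (fun r : ℝ => r) (𝓝[>] 0) (𝓝 0) := nhdsWithin_le_nhds
  have hbound : Tendsto (fun r => 100 * √(ε r) + 800 * √(20 * (ε r + r))) (𝓝[>] 0) (𝓝 0) := by
    have h1 := (hε0.sqrt.const_mul 100).add (((hε0.add hid).const_mul 20).sqrt.const_mul 800)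
    simpa using h1
  refine squeeze_zero' ?_ ?_ hbound
  · filter_upwards with r
    rw [setAverage_eq, smul_eq_mul]
    exact mul_nonneg (by positivity) (integral_nonneg fun _ => abs_nonneg _)
  filter_upwards [Ioc_mem_nhdsGT (dist_pos.2 hax)] with r hr
  obtain ⟨y, -, hyh, hyd, hgrow⟩ := exists_energyGrowth_of_isConnected hG2 hC hfC hx ha hr.1 hr.2
  have hr0 := hr.1
  -- The mean over `B_{r/2}(y)`, a ball inside `B_r(x)`, mediates between `f` near `x` and the value
  -- `h = f y`.
  refine (setAverage_abs_sub_le hG.locInt hr0 (ballMean f y (r / 2)) h).trans (add_le_add ?_ ?_)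
  · exact hG.setAverage_abs_sub_ballMean_le hG2 (by positivity) hr0 (by linarith)
      (Metric.ball_subset_ball' (by linarith))
  · have h1 := hgrow.abs_ballMean_sub_preciseRep_le hG hG2 (by positivity)
    rw [← hprec, hyh] at h1
    refine h1.trans_eq ?_
    congr 2
    simp only [hε]
    field_simp
    ring

theorem isLebesguePoint_of_tendsto {f : Plane → ℝ} (hf : LocallyIntegrable f)
    (hprec : f = preciseRep f) {x : Plane} {h : ℝ}
    (hlim : Tendsto (fun r : ℝ => ⨍ y in Metric.ball x r, |f y - h|) (𝓝[>] 0) (𝓝 0)) :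
    IsLebesguePoint f x ∧ f x = h := by
  have hfx : f x = h := by
    rw [hprec]
    refine preciseRep_eq_of_tendsto (tendsto_iff_norm_sub_tendsto_zero.2 ?_)
    refine squeeze_zero' (Eventually.of_forall fun _ => norm_nonneg _) ?_ hlim
    filter_upwards [self_mem_nhdsWithin] with r hr
    exact abs_ballMean_sub_le hf hr h
  exact ⟨by rwa [IsLebesguePoint, hfx], hfx⟩

theorem isLebesguePoint_of_isConnected {f : Plane → ℝ} (hf : MemW12 f)
    (hprec : f = preciseRep f) {C : Set Plane} (hC : IsConnected C) (hdiam : 0 < Metric.ediam C)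
    {h : ℝ} (hfC : ∀ᵐ x ∂(μH[1] : Measure Plane), x ∈ C → f x = h) {x : Plane}
    (hx : x ∈ closure C) : IsLebesguePoint f x ∧ f x = h := by
  obtain ⟨-, G, -, hG⟩ := id hf
  exact isLebesguePoint_of_tendsto hG.locInt hprec
    (tendsto_setAverage_of_isConnected hf hprec hC hdiam hfC hx)

/-! ### Closed simple Lipschitz curves and their length measures -/

theorem IsClosedSimpleLipschitz.continuousOn {γ : ℝ → Plane} (hγ : IsClosedSimpleLipschitz γ) :
    ContinuousOn γ (Icc 0 1) := let ⟨_, h⟩ := hγ.lipschitz; h.continuousOn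

theorem IsClosedSimpleLipschitz.isConnected {γ : ℝ → Plane} (hγ : IsClosedSimpleLipschitz γ) :
    IsConnected (curveTrace γ) :=
  (isConnected_Icc zero_le_one).image _ hγ.continuousOn

theorem IsClosedSimpleLipschitz.ne_half {γ : ℝ → Plane} (hγ : IsClosedSimpleLipschitz γ) :
    γ 0 ≠ γ (1 / 2) := fun h => by
  have := hγ.simple ⟨le_rfl, zero_lt_one⟩ ⟨by norm_num, by norm_num⟩ h
  norm_num at this

theorem IsClosedSimpleLipschitz.ediam_pos {γ : ℝ → Plane} (hγ : IsClosedSimpleLipschitz γ) :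
    0 < Metric.ediam (curveTrace γ) :=
  Metric.ediam_pos_iff.2 ⟨γ 0, mem_image_of_mem _ ⟨le_rfl, zero_le_one⟩,
    γ (1 / 2), mem_image_of_mem _ ⟨by norm_num, by norm_num⟩, hγ.ne_half⟩

theorem isLebesguePoint_of_curve {f : Plane → ℝ} (hf : MemW12 f) (hprec : f = preciseRep f)
    {γ : ℝ → Plane} (hγ : IsClosedSimpleLipschitz γ) {h : ℝ}
    (hfγ : ∀ᵐ x ∂(μH[1] : Measure Plane), x ∈ curveTrace γ → f x = h) {x : Plane}
    (hx : x ∈ curveTrace γ) : IsLebesguePoint f x ∧ f x = h :=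
  isLebesguePoint_of_isConnected hf hprec hγ.isConnected hγ.ediam_pos hfγ (subset_closure hx)

theorem IsClosedSimpleLipschitz.curveTrace_eq {γ : ℝ → Plane} (hγ : IsClosedSimpleLipschitz γ) :
    curveTrace γ = γ '' Ico 0 1 := by
  refine Subset.antisymm ?_ (image_mono Ico_subset_Icc_self)
  rintro _ ⟨s, hs, rfl⟩
  rcases hs.2.eq_or_lt with rfl | h1
  · exact ⟨0, ⟨le_rfl, zero_lt_one⟩, hγ.closed⟩
  · exact ⟨s, ⟨hs.1, h1⟩, rfl⟩

theorem IsClosedSimpleLipschitz.measurableSet {γ : ℝ → Plane} (hγ : IsClosedSimpleLipschitz γ) :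
    MeasurableSet (curveTrace γ) :=
  (isCompact_Icc.image_of_continuousOn hγ.continuousOn).measurableSet

theorem IsClosedSimpleLipschitz.hausdorffMeasure_image_eq_zero {γ : ℝ → Plane}
    (hγ : IsClosedSimpleLipschitz γ) {s : Set ℝ} (hs : s ⊆ Icc 0 1) (h0 : volume s = 0) :
    μH[1] (γ '' s) = 0 := by
  obtain ⟨K, hK⟩ := hγ.lipschitz
  have h := (hK.mono hs).hausdorffMeasure_image_le (d := 1) zero_le_one
  rw [hausdorffMeasure_real, h0, mul_zero] at h
  exact le_antisymm h zero_le

/-- The length measure on the trace of a curve. -/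
noncomputable def traceMeasure (γ : ℝ → Plane) : Measure Plane := μH[1].restrict (curveTrace γ)

theorem IsClosedSimpleLipschitz.isFiniteMeasure {γ : ℝ → Plane} (hγ : IsClosedSimpleLipschitz γ) :
    IsFiniteMeasure (traceMeasure γ) := by
  obtain ⟨K, hK⟩ := hγ.lipschitz
  have h := hK.hausdorffMeasure_image_le (d := 1) zero_le_one
  rw [hausdorffMeasure_real] at h
  refine ⟨?_⟩
  rw [traceMeasure, Measure.restrict_apply_univ]
  refine h.trans_lt ?_
  simp

theorem tangentField_apply {γ : ℝ → Plane} (hγ : IsClosedSimpleLipschitz γ) {s : ℝ}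
    (hs : s ∈ Ico (0 : ℝ) 1) : tangentField γ (γ s) = ‖deriv γ s‖⁻¹ • deriv γ s := by
  simp only [tangentField, hγ.simple.leftInvOn_invFunOn hs]

/-- The tangent field uses a chosen inverse of `γ`, so measurability is not evident. On `[0, 1)` the
curve is continuous and injective, hence a measurable embedding, and the field is transported
through it. -/
theorem IsClosedSimpleLipschitz.aestronglyMeasurable_tangentField {γ : ℝ → Plane}
    (hγ : IsClosedSimpleLipschitz γ) :
    AEStronglyMeasurable (tangentField γ) (traceMeasure γ) := by
  have he : MeasurableEmbedding ((Ico (0 : ℝ) 1).domRestrict γ) :=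
    (hγ.continuousOn.mono Ico_subset_Icc_self).measurableEmbedding measurableSet_Ico hγ.simple
  set g : Ico (0 : ℝ) 1 → Plane := fun s => ‖deriv γ s‖⁻¹ • deriv γ s
  have hg : Measurable g := by
    have hd : Measurable fun s : Ico (0 : ℝ) 1 => deriv γ s :=
      (measurable_deriv γ).comp measurable_subtype_coe
    exact hd.norm.inv.smul hd
  have hext := he.measurable_extend hg (measurable_const (a := (0 : Plane)))
  refine hext.stronglyMeasurable.aestronglyMeasurable.congr ?_
  filter_upwards [ae_restrict_mem hγ.measurableSet] with x hx
  rw [hγ.curveTrace_eq] at hx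
  obtain ⟨s, hs, rfl⟩ := hx
  rw [tangentField_apply hγ hs]
  exact he.injective.extend_apply g _ ⟨s, hs⟩

/-- The parameters with `deriv γ s = 0`, which include all points of non-differentiability, form a
null set; its Lipschitz image is `ℋ¹`-null. -/
theorem IsClosedSimpleLipschitz.norm_tangentField {γ : ℝ → Plane}
    (hγ : IsClosedSimpleLipschitz γ)
    (hd : ∀ᵐ s ∂(volume.restrict (Icc (0 : ℝ) 1)), deriv γ s ≠ 0) :
    ∀ᵐ x ∂traceMeasure γ, ‖tangentField γ x‖ = 1 := by
  have h0 : volume {s ∈ Icc (0 : ℝ) 1 | deriv γ s = 0} = 0 := by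
    rw [ae_restrict_iff' measurableSet_Icc] at hd
    refine measure_mono_null (fun s hs => ?_) hd
    simpa [-mem_Icc] using hs
  have h1 := hγ.hausdorffMeasure_image_eq_zero (fun s hs => hs.1) h0
  have h2 : ∀ᵐ x ∂traceMeasure γ, x ∉ γ '' {s ∈ Icc (0 : ℝ) 1 | deriv γ s = 0} :=
    ae_restrict_of_ae (measure_eq_zero_iff_ae_notMem.1 h1)
  filter_upwards [h2, ae_restrict_mem hγ.measurableSet] with x hx hxt
  rw [hγ.curveTrace_eq] at hxt
  obtain ⟨s, hs, rfl⟩ := hxt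
  have hne : deriv γ s ≠ 0 := fun h => hx ⟨s, ⟨Ico_subset_Icc_self hs, h⟩, rfl⟩
  rw [tangentField_apply hγ hs, norm_smul, norm_inv, norm_norm,
    inv_mul_cancel₀ (norm_ne_zero_iff.2 hne)]

theorem IsClosedSimpleLipschitz.integrable_tangentField {γ : ℝ → Plane}
    (hγ : IsClosedSimpleLipschitz γ)
    (hd : ∀ᵐ s ∂(volume.restrict (Icc (0 : ℝ) 1)), deriv γ s ≠ 0) :
    Integrable (tangentField γ) (traceMeasure γ) := by
  have := hγ.isFiniteMeasure
  refine Integrable.of_bound hγ.aestronglyMeasurable_tangentField 1 ?_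
  filter_upwards [hγ.norm_tangentField hd] with x hx using hx.le

/-- The density has norm one almost everywhere. This turns the singularity condition on a boundary
family into one on length measures. -/
theorem IsClosedSimpleLipschitz.variation_curveMeasure {γ : ℝ → Plane}
    (hγ : IsClosedSimpleLipschitz γ)
    (hd : ∀ᵐ s ∂(volume.restrict (Icc (0 : ℝ) 1)), deriv γ s ≠ 0) :
    (curveMeasure γ).variation = traceMeasure γ := by
  have h := Measure.variation_withDensityᵥ (hγ.integrable_tangentField hd)
  refine h.trans ((withDensity_congr_ae (g := 1) ?_).trans withDensity_one)
  filter_upwards [hγ.norm_tangentField hd] with x hx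
  rw [← ofReal_norm, hx, ENNReal.ofReal_one, Pi.one_apply]

/-- The connected trace meets every small circle about `x`, and the distance to `x` does not
increase `ℋ¹`. -/
theorem IsClosedSimpleLipschitz.exists_le_traceMeasure_closedBall {γ : ℝ → Plane}
    (hγ : IsClosedSimpleLipschitz γ) {x : Plane} (hx : x ∈ curveTrace γ) :
    ∃ R > 0, ∀ r ≤ R, r ≤ (traceMeasure γ).real (Metric.closedBall x r) := by
  have := hγ.isFiniteMeasure
  obtain ⟨a, ha, hax⟩ : ∃ a ∈ curveTrace γ, a ≠ x := by
    obtain ⟨a, ha, b, hb, hab⟩ := Metric.ediam_pos_iff.1 hγ.ediam_pos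
    by_cases hax : a = x
    · exact ⟨b, hb, fun hbx => hab (hax.trans hbx.symm)⟩
    · exact ⟨a, ha, hax⟩
  refine ⟨dist a x, dist_pos.2 hax, fun r hr => ?_⟩
  rw [Measure.real, ← ENNReal.ofReal_le_iff_le_toReal (measure_ne_top _ _), traceMeasure,
    Measure.restrict_apply measurableSet_closedBall]
  have hl : LipschitzWith 1 fun y : Plane => dist y x := LipschitzWith.dist_left x
  have h := hl.hausdorffMeasure_image_le (d := 1) zero_le_one
    (Metric.closedBall x r ∩ curveTrace γ)
  simp only [ENNReal.coe_one, ENNReal.one_rpow, one_mul, hausdorffMeasure_real] at h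
  refine le_trans ?_ h
  rw [← sub_zero r, ← Real.volume_Ioo, sub_zero]
  refine measure_mono fun ρ hρ => ?_
  obtain ⟨y, hy, rfl⟩ := hγ.isConnected.Ioo_subset_image_dist (subset_closure hx) ha
    ⟨hρ.1, hρ.2.trans_le hr⟩
  exact ⟨y, ⟨hρ.2.le, hy⟩, rfl⟩

/-- A measure that is at least linear on small balls is doubling along a sequence of radii. -/
theorem frequently_doubling {m : ℝ → ℝ} {R : ℝ} (hR : 0 < R) (hm : ∀ r ≤ R, r ≤ m r) :
    ∃ᶠ r in 𝓝[>] (0 : ℝ), m (2 * r) ≤ 4 * m r := by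
  intro hcon
  simp only [not_le] at hcon
  obtain ⟨u, hu, hsub⟩ := mem_nhdsGT_iff_exists_Ioo_subset.1 hcon
  set r := min (u / 2) (R / 2) with hr
  have hu : 0 < u := hu
  have hr0 : 0 < r := by positivity
  have hru : r ≤ u / 2 := min_le_left _ _
  have hrR : r ≤ R / 2 := min_le_right _ _
  -- If doubling failed at all small radii, `m` would decay like `4⁻ⁿ` along `r / 2ⁿ`, against the
  -- linear lower bound `r / 2ⁿ`.
  have hind : ∀ n : ℕ, 4 ^ n * m (r / 2 ^ n) ≤ m r := by
    intro n
    induction n with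
    | zero => simp
    | succ n ih =>
      have h1 : 4 * m (r / 2 ^ (n + 1)) < m (2 * (r / 2 ^ (n + 1))) := by
        refine hsub ⟨by positivity, ?_⟩
        have : r / 2 ^ (n + 1) ≤ r := div_le_self hr0.le (one_le_pow₀ one_le_two)
        linarith
      have h2 : 2 * (r / 2 ^ (n + 1)) = r / 2 ^ n := by rw [pow_succ]; field_simp
      rw [h2] at h1
      calc (4 : ℝ) ^ (n + 1) * m (r / 2 ^ (n + 1)) = 4 ^ n * (4 * m (r / 2 ^ (n + 1))) := by ring
        _ ≤ 4 ^ n * m (r / 2 ^ n) := by gcongr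
        _ ≤ _ := ih
  obtain ⟨n, hn⟩ := pow_unbounded_of_one_lt (m r / r) (one_lt_two (α := ℝ))
  rw [div_lt_iff₀ hr0] at hn
  have h1 : r / 2 ^ n ≤ m (r / 2 ^ n) := by
    refine hm _ (le_trans (div_le_self hr0.le (one_le_pow₀ one_le_two)) (by linarith))
  have h2 : (4 : ℝ) ^ n * (r / 2 ^ n) = 2 ^ n * r := by
    rw [show (4 : ℝ) = 2 * 2 by norm_num, mul_pow]; field_simp
  have h3 : (4 : ℝ) ^ n * (r / 2 ^ n) ≤ 4 ^ n * m (r / 2 ^ n) := by gcongr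
  linarith [hind n]

/-! ### Pairing a vector measure with a field of fixed direction -/

/-- The scalar component of a vector measure in the direction `c`. -/
noncomputable def componentMeasure (D : VectorMeasure Plane Plane) (c : Plane) :
    SignedMeasure Plane :=
  D.mapRange (innerSL ℝ c : Plane →L[ℝ] ℝ).toLinearMap.toAddMonoidHom (innerSL ℝ c).continuous

theorem componentMeasure_apply (D : VectorMeasure Plane Plane) (c : Plane) (s : Set Plane) :
    componentMeasure D c s = inner ℝ c (D s) := by
  simp [componentMeasure]

theorem isFiniteMeasure_variation_signed (s : SignedMeasure Plane) :
    IsFiniteMeasure (VectorMeasure.variation s) := by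
  rw [← SignedMeasure.totalVariation_eq_variation]; infer_instance

/-- The two coordinates are signed measures, whose total variations are finite, and their sum
dominates the variation of `D`. -/
theorem isFiniteMeasure_variation (D : VectorMeasure Plane Plane) :
    IsFiniteMeasure D.variation := by
  set D0 := componentMeasure D (EuclideanSpace.single 0 1)
  set D1 := componentMeasure D (EuclideanSpace.single 1 1)
  have h0 := isFiniteMeasure_variation_signed D0
  have h1 := isFiniteMeasure_variation_signed D1
  refine isFiniteMeasure_of_le (VectorMeasure.variation D0 + VectorMeasure.variation D1) ?_
  refine VectorMeasure.variation_le_of_forall_enorm_le fun s _ => ?_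
  have hs : D s = D0 s • EuclideanSpace.single 0 1 + D1 s • EuclideanSpace.single 1 1 := by
    simp only [D0, D1, componentMeasure_apply, EuclideanSpace.inner_single_left]
    ext i; fin_cases i <;> simp
  rw [hs, Measure.add_apply]
  refine (enorm_add_le _ _).trans (add_le_add ?_ ?_)
  · rw [enorm_smul]
    simpa [← ofReal_norm] using VectorMeasure.enorm_measure_le_variation D0 s
  · rw [enorm_smul]
    simpa [← ofReal_norm] using VectorMeasure.enorm_measure_le_variation D1 s

/-- Both integrals extend the same operator-valued set function, so it is enough to compare the
transposes on measurable sets. The reduction makes signed-measure bounds available. -/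
theorem integral_smul_const_eq {D : VectorMeasure Plane Plane} {χ : Plane → ℝ} (c : Plane)
    (hχ : Continuous χ) (hχc : HasCompactSupport χ) :
    D.integral (fun y => χ y • c) (innerSL ℝ)
      = (componentMeasure D c).integral χ (ContinuousLinearMap.lsmul ℝ ℝ).flip := by
  have := isFiniteMeasure_variation D
  have := isFiniteMeasure_variation_signed (componentMeasure D c)
  have hi1 : Integrable χ D.variation := hχ.integrable_of_hasCompactSupport hχc
  have hi2 : Integrable χ (componentMeasure D c).variation :=
    hχ.integrable_of_hasCompactSupport hχc
  have h := VectorMeasure.integral_continuousLinearMap_comp (B := innerSL ℝ)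
    (C := ContinuousLinearMap.toSpanSingleton ℝ c) hi1
  simp only [ContinuousLinearMap.toSpanSingleton_apply] at h
  rw [h, VectorMeasure.integral_eq_setToFun_transpose hi1,
    VectorMeasure.integral_eq_setToFun_transpose hi2]
  have hT : D.transpose ((innerSL ℝ) ∘L (ContinuousLinearMap.toSpanSingleton ℝ c))
      = (componentMeasure D c).transpose (ContinuousLinearMap.lsmul ℝ ℝ).flip := by
    ext s hs
    change inner ℝ ((1 : ℝ) • c) (D s) = componentMeasure D c s • (1 : ℝ)
    simp [componentMeasure_apply]
  simp only [hT]

/-- The setwise bound says that `σ` dominates the variation of the difference between the component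
of `D` and `m`; integrating `χ` gives the estimate. -/
theorem abs_integral_componentMeasure_sub_le {D : VectorMeasure Plane Plane} {c : Plane}
    {m σ : Measure Plane} [IsFiniteMeasure m] [IsFiniteMeasure σ]
    (hσ : ∀ s, MeasurableSet s → ‖inner ℝ c (D s) - m.real s‖ₑ ≤ σ s) {χ : Plane → ℝ}
    (hχ : Continuous χ) (hχc : HasCompactSupport χ) :
    |D.integral (fun y => χ y • c) (innerSL ℝ) - ∫ y, χ y ∂m| ≤ ∫ y, |χ y| ∂σ := by
  have := isFiniteMeasure_variation_signed (componentMeasure D c)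
  have hi1 : Integrable χ (componentMeasure D c).variation :=
    hχ.integrable_of_hasCompactSupport hχc
  have hi2 : Integrable χ m.toSignedMeasure.variation := by
    rw [Measure.variation_toSignedMeasure]
    exact hχ.integrable_of_hasCompactSupport hχc
  have hσi : Integrable χ σ := hχ.integrable_of_hasCompactSupport hχc
  rw [integral_smul_const_eq c hχ hχc, ← VectorMeasure.integral_toSignedMeasure (μ := m),
    ← VectorMeasure.integral_sub_vectorMeasure hi1 hi2, ← Real.norm_eq_abs]
  have hle : VectorMeasure.variation (componentMeasure D c - m.toSignedMeasure) ≤ σ := by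
    refine VectorMeasure.variation_le_of_forall_enorm_le fun s hs => ?_
    rw [sub_apply, componentMeasure_apply,
      Measure.toSignedMeasure_apply_measurable hs]
    exact hσ s hs
  refine VectorMeasure.norm_integral_le_integral_norm.trans ?_
  have hB : ‖((ContinuousLinearMap.lsmul ℝ ℝ).flip : ℝ →L[ℝ] ℝ →L[ℝ] ℝ)‖ ≤ 1 := by
    rw [ContinuousLinearMap.opNorm_flip]
    exact ContinuousLinearMap.opNorm_lsmul_le
  calc _ ≤ 1 * ∫ y, ‖χ y‖
        ∂(VectorMeasure.variation (componentMeasure D c - m.toSignedMeasure)) := by gcongr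
    _ ≤ _ := by
        rw [one_mul]
        exact integral_mono_measure hle (by filter_upwards; simp) hσi.norm

/-! ### Cutoffs and the essential boundary -/

/-- A fixed smooth cutoff, equal to `1` on the unit ball and vanishing off the ball of
radius `2`. -/
noncomputable def unitBump : ContDiffBump (0 : Plane) := ⟨1, 2, zero_lt_one, one_lt_two⟩

/-- The smooth cutoff adapted to the ball of radius `r` about `x`. -/
noncomputable def cutoff (x : Plane) (r : ℝ) (y : Plane) : ℝ := unitBump (r⁻¹ • (y - x))

theorem contDiff_cutoff (x : Plane) (r : ℝ) : ContDiff ℝ ∞ (cutoff x r) :=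
  (unitBump.contDiff (n := ⊤)).comp (by fun_prop)

theorem norm_inv_smul_sub (x y : Plane) {r : ℝ} (hr : 0 < r) :
    ‖r⁻¹ • (y - x)‖ = dist y x / r := by
  rw [norm_smul, norm_inv, Real.norm_of_nonneg hr.le, dist_eq_norm, inv_mul_eq_div]

theorem cutoff_eq_one {x y : Plane} {r : ℝ} (hr : 0 < r) (hy : y ∈ Metric.closedBall x r) :
    cutoff x r y = 1 := by
  refine unitBump.one_of_mem_closedBall ?_
  rw [mem_closedBall_zero_iff, norm_inv_smul_sub x y hr, div_le_iff₀ hr]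
  simpa [unitBump] using hy

theorem cutoff_eq_zero {x y : Plane} {r : ℝ} (hr : 0 < r) (hy : y ∉ Metric.closedBall x (2 * r)) :
    cutoff x r y = 0 := by
  refine unitBump.zero_of_le_dist ?_
  rw [dist_zero_right, norm_inv_smul_sub x y hr, le_div_iff₀ hr]
  simpa [unitBump] using (not_le.1 hy).le

theorem cutoff_nonneg (x : Plane) (r : ℝ) (y : Plane) : 0 ≤ cutoff x r y := unitBump.nonneg

theorem cutoff_le_one (x : Plane) (r : ℝ) (y : Plane) : cutoff x r y ≤ 1 := unitBump.le_one

theorem tsupport_cutoff_subset (x : Plane) {r : ℝ} (hr : 0 < r) :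
    tsupport (cutoff x r) ⊆ Metric.closedBall x (2 * r) := by
  refine closure_minimal (fun y hy => ?_) Metric.isClosed_closedBall
  by_contra h
  exact hy (cutoff_eq_zero hr h)

theorem hasCompactSupport_cutoff (x : Plane) {r : ℝ} (hr : 0 < r) :
    HasCompactSupport (cutoff x r) :=
  (isCompact_closedBall x (2 * r)).of_isClosed_subset (isClosed_tsupport _)
    (tsupport_cutoff_subset x hr)

theorem isTestField_cutoff (x c : Plane) {r : ℝ} (hr : 0 < r) :
    IsTestField fun y => cutoff x r y • c :=
  ⟨(contDiff_cutoff x r).smul contDiff_const, (hasCompactSupport_cutoff x hr).smul_right⟩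

theorem divergence_cutoff (x c : Plane) (r : ℝ) (y : Plane) :
    divergence (fun y => cutoff x r y • c) y = fderiv ℝ (cutoff x r) y c :=
  divergence_smul_const ((contDiff_cutoff x r).differentiable (by simp) y) c

theorem exists_norm_fderiv_cutoff_le :
    ∃ L > 0, ∀ (x : Plane) (r : ℝ), 0 < r → ∀ y, ‖fderiv ℝ (cutoff x r) y‖ ≤ L / r := by
  have hs : ContDiff ℝ ∞ unitBump := unitBump.contDiff
  obtain ⟨L, hL⟩ := (unitBump.hasCompactSupport.fderiv ℝ).exists_bound_of_continuous
    (hs.continuous_fderiv (by simp))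
  refine ⟨max L 1, by positivity, fun x r hr y => ?_⟩
  have h1 : HasFDerivAt (fun y : Plane => r⁻¹ • (y - x)) (r⁻¹ • ContinuousLinearMap.id ℝ Plane) y :=
    ((hasFDerivAt_id y).sub_const x).const_smul r⁻¹
  have h2 : HasFDerivAt (cutoff x r) ((fderiv ℝ unitBump (r⁻¹ • (y - x))).comp
      (r⁻¹ • ContinuousLinearMap.id ℝ Plane)) y :=
    ((hs.differentiable (by simp) _).hasFDerivAt).comp y h1
  rw [h2.fderiv, ContinuousLinearMap.comp_smul, ContinuousLinearMap.comp_id, norm_smul, norm_inv,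
    Real.norm_of_nonneg hr.le, inv_mul_eq_div]
  gcongr
  exact (hL _).trans (le_max_left _ _)

theorem integral_divergence_cutoff (x c : Plane) {r : ℝ} (hr : 0 < r) :
    ∫ y, divergence (fun y => cutoff x r y • c) y = 0 := by
  simp only [divergence_cutoff]
  have hs := contDiff_cutoff x r
  have hfc : Continuous fun y => fderiv ℝ (cutoff x r) y c :=
    (hs.continuous_fderiv (by simp)).clm_apply continuous_const
  have hfi : Integrable fun y => fderiv ℝ (cutoff x r) y c :=
    hfc.integrable_of_hasCompactSupport ((hasCompactSupport_cutoff x hr).fderiv_apply ℝ c)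
  have h := integral_mul_fderiv_eq_neg_fderiv_mul_of_integrable (μ := (volume : Measure Plane))
    (f := fun _ : Plane => (1 : ℝ)) (g := cutoff x r) (v := c) (by simp) (by simpa using hfi)
    (by simpa using hs.continuous.integrable_of_hasCompactSupport (hasCompactSupport_cutoff x hr))
    (fun _ _ => by fun_prop) (fun y _ => hs.differentiable (by simp) y)
  simpa using h

theorem integrable_divergence_cutoff (x c : Plane) {r : ℝ} (hr : 0 < r) :
    Integrable (divergence fun y => cutoff x r y • c) := by
  have hfc : Continuous fun y => fderiv ℝ (cutoff x r) y c :=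
    ((contDiff_cutoff x r).continuous_fderiv (by simp)).clm_apply continuous_const
  have h := hfc.integrable_of_hasCompactSupport (μ := volume)
    ((hasCompactSupport_cutoff x hr).fderiv_apply ℝ c)
  exact h.congr (Eventually.of_forall fun y => (divergence_cutoff x c r y).symm)

/-- The gradient of the cutoff has size at most `L / r` and lives in the closed ball of radius `2r`.
The radius `3r` gives room for an open ball, as in the definition of density. -/
theorem enorm_setIntegral_divergence_cutoff_le {L : ℝ} (hL0 : 0 < L)
    (hL : ∀ (x : Plane) (r : ℝ), 0 < r → ∀ y, ‖fderiv ℝ (cutoff x r) y‖ ≤ L / r)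
    (F : Set Plane) (x : Plane) {c : Plane} (hc : ‖c‖ ≤ 1) {r : ℝ} (hr : 0 < r) :
    ‖∫ y in F, divergence (fun y => cutoff x r y • c) y‖ₑ
      ≤ ENNReal.ofReal (L / r) * volume (Metric.ball x (3 * r) ∩ F) := by
  refine (enorm_integral_le_lintegral_enorm _).trans ?_
  calc ∫⁻ y in F, ‖divergence (fun y => cutoff x r y • c) y‖ₑ
      ≤ ∫⁻ y in F, (Metric.ball x (3 * r)).indicator (fun _ => ENNReal.ofReal (L / r)) y := by
        refine lintegral_mono fun y => ?_
        rw [divergence_cutoff]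
        by_cases hy : y ∈ Metric.ball x (3 * r)
        · rw [indicator_of_mem hy, ← ofReal_norm]
          refine ENNReal.ofReal_le_ofReal ?_
          calc _ ≤ ‖fderiv ℝ (cutoff x r) y‖ * ‖c‖ := ContinuousLinearMap.le_opNorm _ _
            _ ≤ L / r * 1 := by gcongr; exact hL x r hr y
            _ = L / r := mul_one _
        · have h0 : fderiv ℝ (cutoff x r) y = 0 := by
            by_contra h
            have h1 := tsupport_cutoff_subset x hr (support_fderiv_subset ℝ h)
            exact hy (Metric.closedBall_subset_ball (by linarith) h1)
          simp [h0]
    _ = _ := by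
        rw [lintegral_indicator_const measurableSet_ball, Measure.restrict_apply measurableSet_ball]

/-- A set on which the divergence of rescaled cutoffs has a large integral does not have density
zero. -/
theorem notMem_densityPoints_zero {F : Set Plane} {x c : Plane} (hc : ‖c‖ ≤ 1)
    (h : ∃ᶠ r in 𝓝[>] (0 : ℝ),
      r / 8 ≤ |∫ y in F, divergence (fun y => cutoff x r y • c) y|) :
    x ∉ densityPoints F 0 := by
  intro hx
  obtain ⟨L, hL0, hL⟩ := exists_norm_fderiv_cutoff_le
  have h3 : Tendsto (fun r : ℝ => 3 * r) (𝓝[>] 0) (𝓝[>] 0) := by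
    refine tendsto_nhdsWithin_iff.2 ⟨?_, ?_⟩
    · have : Continuous fun r : ℝ => 3 * r := by fun_prop
      simpa using (this.tendsto 0).mono_left (nhdsWithin_le_nhds (s := Ioi 0))
    · filter_upwards [self_mem_nhdsWithin] with r hr
      simpa using hr
  -- Solves `(L / r) * κ * π (3r)² = r / 8`, so relative density below `κ` contradicts the lower
  -- bound.
  set κ : ℝ := 1 / (8 * L * (Real.pi * 9)) with hκ
  have hκ0 : 0 < κ := by positivity
  have hev := (Tendsto.comp hx h3).eventually (gt_mem_nhds (ENNReal.ofReal_pos.2 hκ0))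
  obtain ⟨r, hr1, hr2, hr0⟩ := (h.and_eventually (hev.and self_mem_nhdsWithin)).exists
  have hr0 : 0 < r := hr0
  have hb := enorm_setIntegral_divergence_cutoff_le hL0 hL F x hc hr0
  have hfin : volume (Metric.ball x (3 * r) ∩ F) ≠ ⊤ :=
    ((measure_mono inter_subset_left).trans_lt measure_ball_lt_top).ne
  rw [Function.comp_apply, volume_ball_eq_ofReal (by positivity), ENNReal.div_lt_iff
    (Or.inl (ENNReal.ofReal_pos.2 (by positivity)).ne') (Or.inl ENNReal.ofReal_ne_top),
    ← ENNReal.ofReal_mul hκ0.le, ← ENNReal.ofReal_toReal hfin,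
    ENNReal.ofReal_lt_ofReal_iff (by positivity)] at hr2
  rw [← ENNReal.ofReal_toReal hfin, ← ENNReal.ofReal_mul (by positivity), ← ofReal_norm,
    ENNReal.ofReal_le_ofReal_iff (by positivity), Real.norm_eq_abs] at hb
  have h4 : L / r * (volume (Metric.ball x (3 * r) ∩ F)).toReal
      < L / r * (κ * (Real.pi * (3 * r) ^ 2)) := by gcongr
  have h5 : L / r * (κ * (Real.pi * (3 * r) ^ 2)) = r / 8 := by
    rw [hκ]; field_simp; ring
  linarith

theorem densityPoints_one_subset_compl {E : Set Plane} (hE : NullMeasurableSet E) :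
    densityPoints E 1 ⊆ densityPoints Eᶜ 0 := by
  intro x hx
  have h := ENNReal.Tendsto.sub (tendsto_const_nhds (x := (1 : ℝ≥0∞)) (f := 𝓝[>] (0 : ℝ))) hx
    (Or.inl ENNReal.one_ne_top)
  rw [tsub_self] at h
  refine h.congr' ?_
  filter_upwards [self_mem_nhdsWithin] with r hr
  have hb0 : volume (Metric.ball x r) ≠ 0 := (Metric.measure_ball_pos _ _ hr).ne'
  have hbt : volume (Metric.ball x r) ≠ ⊤ := measure_ball_lt_top.ne
  have hfin : volume (Metric.ball x r ∩ E) ≠ ⊤ :=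
    ((measure_mono inter_subset_left).trans_lt measure_ball_lt_top).ne
  have hadd := measure_inter_add_sdiff₀ (Metric.ball x r) hE
  rw [← ENNReal.div_self hb0 hbt, ← ENNReal.sub_div fun _ _ => hb0]
  congr 1
  conv_lhs => rw [← hadd, ENNReal.add_sub_cancel_left hfin]
  rfl

/-- Density one is density zero of the complement, and the divergence of a compactly supported field
integrates to zero, so the integral over the complement has the same absolute value. -/
theorem mem_essentialBoundary {E : Set Plane} (hE : NullMeasurableSet E) {x c : Plane}
    (hc : ‖c‖ ≤ 1)
    (h : ∃ᶠ r in 𝓝[>] (0 : ℝ),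
      r / 8 ≤ |∫ y in E, divergence (fun y => cutoff x r y • c) y|) :
    x ∈ essentialBoundary E := by
  rintro (h0 | h1)
  · exact notMem_densityPoints_zero hc h h0
  · refine notMem_densityPoints_zero hc ?_ (densityPoints_one_subset_compl hE h1)
    refine (h.and_eventually self_mem_nhdsWithin).mono fun r hr => ?_
    rw [setIntegral_compl₀ hE (integrable_divergence_cutoff x c hr.2),
      integral_divergence_cutoff x c hr.2, zero_sub, abs_neg]
    exact hr.1

/-- If near `x` the component of `D 𝟙_E` in the direction `c` is close to a positive measure that
is at least linear on balls, then `x` belongs to the essential boundary. -/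
theorem IsIndicatorGradient.mem_essentialBoundary {E : Set Plane} (hE : NullMeasurableSet E)
    {D : VectorMeasure Plane Plane} (hD : IsIndicatorGradient E D) {m σ : Measure Plane}
    [IsFiniteMeasure m] [IsFiniteMeasure σ] {x c : Plane} (hc : ‖c‖ ≤ 1)
    (hσ : ∀ s, MeasurableSet s → ‖inner ℝ c (D s) - m.real s‖ₑ ≤ σ s)
    {R : ℝ} (hR : 0 < R) (hm : ∀ r ≤ R, r ≤ m.real (Metric.closedBall x r))
    (hlim : Tendsto (fun r => σ (Metric.closedBall x r) / m (Metric.closedBall x r))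
      (𝓝[>] 0) (𝓝 0)) :
    x ∈ essentialBoundary E := by
  refine _root_.mem_essentialBoundary hE hc ?_
  have h2 : Tendsto (fun r : ℝ => 2 * r) (𝓝[>] 0) (𝓝[>] 0) := by
    refine tendsto_nhdsWithin_iff.2 ⟨?_, ?_⟩
    · have : Continuous fun r : ℝ => 2 * r := by fun_prop
      simpa using (this.tendsto 0).mono_left (nhdsWithin_le_nhds (s := Ioi 0))
    · filter_upwards [self_mem_nhdsWithin] with r hr
      simpa using hr
  have hsmall := (hlim.comp h2).eventually
    (gt_mem_nhds (ENNReal.ofReal_pos.2 (show (0 : ℝ) < 1 / 8 by norm_num)))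
  -- At such radii the error is at most `m(B_{2r}) / 8 ≤ m(B_r) / 2`, so the pairing is at least
  -- `m(B_r) / 2 ≥ r / 2`, more than the required `r / 8`.
  refine ((frequently_doubling hR hm).and_eventually
    (hsmall.and (Ioc_mem_nhdsGT hR))).mono fun r ⟨hdoub, hsm, hr⟩ => ?_
  have hr0 : 0 < r := hr.1
  have hmr := hm r hr.2
  set B := Metric.closedBall x (2 * r) with hB
  have hmB : r ≤ m.real B := hmr.trans
    (measureReal_mono (Metric.closedBall_subset_closedBall (by linarith)))
  have hmB0 : m B ≠ 0 := fun h => by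
    rw [Measure.real, h, ENNReal.toReal_zero] at hmB; linarith
  have hσm : σ.real B ≤ 1 / 8 * m.real B := by
    rw [Function.comp_apply, ENNReal.div_lt_iff (Or.inl hmB0) (Or.inl (measure_ne_top _ _))] at hsm
    have := ENNReal.toReal_mono (ENNReal.mul_ne_top ENNReal.ofReal_ne_top (measure_ne_top _ _))
      hsm.le
    rwa [ENNReal.toReal_mul, ENNReal.toReal_ofReal (by norm_num)] at this
  have hcont := (contDiff_cutoff x r).continuous
  have hcs := hasCompactSupport_cutoff x hr0
  have hpair := abs_integral_componentMeasure_sub_le hσ hcont hcs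
  have hlow : m.real (Metric.closedBall x r) ≤ ∫ y, cutoff x r y ∂m := by
    rw [← integral_indicator_one measurableSet_closedBall]
    refine integral_mono ((integrable_const _).indicator measurableSet_closedBall)
      (hcont.integrable_of_hasCompactSupport hcs) fun y => ?_
    by_cases hy : y ∈ Metric.closedBall x r
    · rw [indicator_of_mem hy, cutoff_eq_one hr0 hy, Pi.one_apply]
    · rw [indicator_of_notMem hy]; exact cutoff_nonneg x r y
  have hup : ∫ y, |cutoff x r y| ∂σ ≤ σ.real B := by
    rw [← integral_indicator_one measurableSet_closedBall]
    refine integral_mono (hcont.integrable_of_hasCompactSupport hcs).abs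
      ((integrable_const _).indicator measurableSet_closedBall) fun y => ?_
    by_cases hy : y ∈ B
    · rw [indicator_of_mem hy, abs_of_nonneg (cutoff_nonneg x r y), Pi.one_apply]
      exact cutoff_le_one x r y
    · rw [cutoff_eq_zero hr0 hy, abs_zero]
      exact indicator_nonneg (fun _ _ => zero_le_one) y
  rw [hD _ (isTestField_cutoff x c hr0), abs_neg]
  refine le_trans ?_ (le_abs_self _)
  have h3 := (abs_le.1 hpair).1
  linarith

/-! ### Boundary curves lie in the essential boundary almost everywhere -/

theorem perpMeasure_apply (μ : VectorMeasure Plane Plane) (s : Set Plane) :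
    perpMeasure μ s = perp (μ s) := rfl

theorem norm_perp (a : Plane) : ‖perp a‖ = ‖a‖ := by
  simp [perp, EuclideanSpace.norm_eq, add_comm]

theorem inner_perp_perp (a b : Plane) : inner ℝ (perp a) (perp b) = inner ℝ a b := by
  simp [perp, PiLp.inner_apply, add_comm]

/-- Rotation preserves inner products and `⟪a, a⟫ = 1`, so the difference is the integral of `⟪a, τ
- a⟫`; Cauchy–Schwarz bounds it. -/
theorem enorm_inner_perp_sub_le {γ : ℝ → Plane} (hγ : IsClosedSimpleLipschitz γ)
    (hd : ∀ᵐ s ∂(volume.restrict (Icc (0 : ℝ) 1)), deriv γ s ≠ 0) {a : Plane} (ha : ‖a‖ = 1)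
    {s : Set Plane} (hs : MeasurableSet s) :
    ‖inner ℝ (perp a) (perpMeasure (curveMeasure γ) s) - (traceMeasure γ).real s‖ₑ
      ≤ ∫⁻ y in s, ‖tangentField γ y - a‖ₑ ∂traceMeasure γ := by
  have := hγ.isFiniteMeasure
  have hi := hγ.integrable_tangentField hd
  have h1 : perpMeasure (curveMeasure γ) s = perp (∫ y in s, tangentField γ y ∂traceMeasure γ) := by
    rw [perpMeasure_apply, curveMeasure]
    exact congrArg perp (withDensityᵥ_apply hi hs)
  have hii : Integrable (fun y => inner ℝ a (tangentField γ y)) ((traceMeasure γ).restrict s) :=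
    hi.restrict.const_inner a
  have h2 : inner ℝ a (∫ y in s, tangentField γ y ∂traceMeasure γ) - (traceMeasure γ).real s
      = ∫ y in s, inner ℝ a (tangentField γ y - a) ∂traceMeasure γ := by
    simp only [inner_sub_right, real_inner_self_eq_norm_sq, ha, one_pow]
    rw [integral_sub hii (integrable_const _), integral_inner hi.restrict]
    simp
  rw [h1, inner_perp_perp, h2]
  refine (enorm_integral_le_lintegral_enorm _).trans (lintegral_mono fun y => ?_)
  rw [enorm_le_iff_norm_le]
  simpa [ha] using norm_inner_le_norm (𝕜 := ℝ) a (tangentField γ y - a)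

open scoped Classical in
/-- The total length measure of all curves of a family but one. -/
noncomputable def otherCurvesMeasure {ι : Type} (γ : ι → ℝ → Plane) (i : ι) : Measure Plane :=
  Measure.sum (Function.update (fun j => (curveMeasure (γ j)).variation) i 0)

theorem enorm_sub_le_otherCurvesMeasure {ι : Type} {γ : ι → ℝ → Plane} {v : Plane} {s : Set Plane}
    (hs : MeasurableSet s) (h : HasSum (fun j => perpMeasure (curveMeasure (γ j)) s) v) (i : ι) :
    ‖v - perpMeasure (curveMeasure (γ i)) s‖ₑ ≤ otherCurvesMeasure γ i s := by
  classical
  have h1 := h.update i 0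
  rw [zero_sub, neg_add_eq_sub] at h1
  rw [← h1.tsum_eq, otherCurvesMeasure, Measure.sum_apply _ hs]
  refine enorm_tsum_le_tsum_enorm.trans (ENNReal.tsum_le_tsum fun j => ?_)
  rcases eq_or_ne j i with rfl | hj
  · simp
  · rw [Function.update_of_ne hj, Function.update_of_ne hj]
    refine le_trans ?_ (VectorMeasure.enorm_measure_le_variation _ _)
    rw [perpMeasure_apply, enorm_le_iff_norm_le]
    exact (norm_perp _).le

/-- Almost every point of a curve of the family lies in the essential boundary. -/
theorem IsBoundaryCurveFamily.ae_mem_essentialBoundary {ι : Type} {E : Set Plane}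
    (hE : NullMeasurableSet E) {γ : ι → ℝ → Plane} (h : IsBoundaryCurveFamily E γ) (i : ι) :
    ∀ᵐ x ∂traceMeasure (γ i), x ∈ essentialBoundary E := by
  classical
  obtain ⟨D, hD, hsum, hvar⟩ := h.gradient_eq
  have := h.countable
  have hγ := h.curve i
  have hd := h.deriv_ne_zero i
  have := hγ.isFiniteMeasure
  have := isFiniteMeasure_variation D
  set m := traceMeasure (γ i) with hm
  set ρ := otherCurvesMeasure γ i with hρ
  -- Here the identity `|D 𝟙_E| = ∑ |μ_γ|` enters: it rules out infinite total length.
  have hρfin : IsFiniteMeasure ρ := by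
    refine isFiniteMeasure_of_le D.variation ?_
    rw [hvar, Measure.le_iff]
    intro s hs
    rw [hρ, otherCurvesMeasure, Measure.sum_apply _ hs, Measure.sum_apply _ hs]
    refine ENNReal.tsum_le_tsum fun j => ?_
    rcases eq_or_ne j i with rfl | hj
    · simp
    · rw [Function.update_of_ne hj]
  have hsing : ρ ⟂ₘ m := by
    rw [hρ, otherCurvesMeasure, Measure.MutuallySingular.sum_left]
    intro j
    rcases eq_or_ne j i with rfl | hj
    · simp
    · rw [Function.update_of_ne hj, hm, ← hγ.variation_curveMeasure hd]
      exact h.singular hj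
  have hint := hγ.integrable_tangentField hd
  -- Generic points: the other curves have density zero relative to `m`, and `x` is a Lebesgue point
  -- of the tangent field, which has norm one there.
  filter_upwards [Besicovitch.ae_tendsto_rnDeriv ρ m, hsing.rnDeriv_ae_eq_zero,
    (Besicovitch.vitaliFamily m).ae_tendsto_lintegral_enorm_sub_div_of_integrable hint,
    hγ.norm_tangentField hd, ae_restrict_mem hγ.measurableSet] with x h1 h2 h3 h4 h5
  obtain ⟨R, hR, hlow⟩ := hγ.exists_le_traceMeasure_closedBall h5
  rw [h2, Pi.zero_apply] at h1
  replace h3 := h3.comp (Besicovitch.tendsto_filterAt m x)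
  set τ := tangentField (γ i) with hτ
  -- The error is the oscillation of the tangent along this curve plus the length of all the others;
  -- both are negligible against `m` on small balls.
  set σ := m.withDensity (fun y => ‖τ y - τ x‖ₑ) + ρ with hσ
  have hfin : IsFiniteMeasure (m.withDensity fun y => ‖τ y - τ x‖ₑ) :=
    isFiniteMeasure_withDensity (hint.sub (integrable_const _)).2.ne
  refine hD.mem_essentialBoundary hE (m := m) (σ := σ) (c := perp (τ x))
    (by rw [norm_perp, h4]) (fun s hs => ?_) hR hlow ?_
  · have e1 : inner ℝ (perp (τ x)) (D s) - m.real s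
        = (inner ℝ (perp (τ x)) (perpMeasure (curveMeasure (γ i)) s) - m.real s)
          + inner ℝ (perp (τ x)) (D s - perpMeasure (curveMeasure (γ i)) s) := by
      rw [inner_sub_right]; ring
    rw [e1, hσ, Measure.add_apply, withDensity_apply _ hs]
    refine (enorm_add_le _ _).trans (add_le_add (enorm_inner_perp_sub_le hγ hd h4 hs) ?_)
    refine le_trans ?_ (enorm_sub_le_otherCurvesMeasure hs (hsum s hs) i)
    rw [enorm_le_iff_norm_le]
    have := norm_inner_le_norm (𝕜 := ℝ) (perp (τ x)) (D s - perpMeasure (curveMeasure (γ i)) s)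
    rwa [norm_perp, h4, one_mul] at this
  · have h6 := h3.add h1
    rw [add_zero] at h6
    refine h6.congr fun r => ?_
    rw [hσ, Measure.add_apply, withDensity_apply _ measurableSet_closedBall, ENNReal.add_div]
    rfl

/-! ### Regular values and conclusion -/

theorem IsRegularValue.ae_eq_of_isBoundaryCurveFamily {f : Plane → ℝ} {t : ℝ}
    (hf : IsRegularValue f t) {ι : Type} {γ : ι → ℝ → Plane}
    (h : IsBoundaryCurveFamily {x | t < f x} γ) (i : ι) :
    ∀ᵐ x ∂(μH[1] : Measure Plane), x ∈ curveTrace (γ i) → f x = t := by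
  have h1 := h.ae_mem_essentialBoundary hf.finitePerimeter.nullMeasurable i
  rw [traceMeasure, ae_restrict_iff' (h.curve i).measurableSet] at h1
  filter_upwards [h1, hf.boundary_eq.mem_iff] with x hx1 hx2 hx
  exact hx2.1 (hx1 hx)

theorem mainTheorem8 (f : Plane → ℝ) (hf : MemW12 f) (hprec : f = preciseRep f) :
    (∀ (h : ℝ) (C : Set Plane), IsConnected C → 0 < Metric.ediam C →
      (∀ᵐ x ∂(μH[1] : Measure Plane), x ∈ C → f x = h) →
      ∀ x ∈ closure C, IsLebesguePoint f x ∧ f x = h) ∧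
    (∀ (γ : ℝ → Plane) (h : ℝ), IsClosedSimpleLipschitz γ →
      (∀ᵐ x ∂(μH[1] : Measure Plane), x ∈ curveTrace γ → f x = h) →
      ∀ t ∈ Icc (0 : ℝ) 1, IsLebesguePoint f (γ t) ∧ f (γ t) = h) ∧
    (∀ h : ℝ, IsRegularValue f h → ∀ S : Set Plane, IsEssentialLevelSet f h S →
      (∀ x ∈ S, IsLebesguePoint f x) ∧ S ⊆ {x | f x = h}) := by
  refine ⟨fun h C hC hd hfC x hx => isLebesguePoint_of_isConnected hf hprec hC hd hfC hx,
    fun γ h hγ hfγ t ht => isLebesguePoint_of_curve hf hprec hγ hfγ (mem_image_of_mem γ ht), ?_⟩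
  rintro h hreg S ⟨ι, γ, hfam, rfl⟩
  have key : ∀ x ∈ ⋃ i, curveTrace (γ i), IsLebesguePoint f x ∧ f x = h := by
    intro x hx
    obtain ⟨i, hi⟩ := mem_iUnion.1 hx
    exact isLebesguePoint_of_curve hf hprec (hfam.curve i)
      (hreg.ae_eq_of_isBoundaryCurveFamily hfam i) hi
  exact ⟨fun x hx => (key x hx).1, fun x hx => (key x hx).2⟩
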